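/- **Model.** There are $k$ sites $P_1,\dots,P_k$; site $P_i$ holds a set $S_i\subseteq[n]$. The sites communicate point-to-point: in each step one site sends one bit to one other site, and this bit depends only on the sender's own input, its random tape, and the bits it has itself sent or received so far; the transcript (the sequence of all bits sent so far) specifies who speaks next and to whom, and when and by whom the answer is reported. The random tapes may be private or shared. A randomized protocol has error $\delta$ if on every admissible input it outputs a correct answer with probability at least $1-\delta$; its cost is the maximum total number of bits sent, over all admissible inputs and all random tapes. $R^{\delta}(f)$ is the minimum cost of a randomized protocol for the problem $f$ with error $\delta$. **Problem.** The frequency of $a\in[n]$ is $|\{i : a\in S_i\}|$, and $\ell_\infty(S_1,\dots,S_k)$ is the maximum frequency. For an integer $L$, let $\mathrm{MAX}_{n,k,L}$ be the problem of finding an element of $\bigcup_i S_i$ of maximum frequency, and $\mathrm{VAL}_{n,k,L}$ that of computing the number $\ell_\infty(S_1,\dots,S_k)$ exactly, both restricted to the inputs of maximum frequency of order $L$ (capped at $k$), namely $\tfrac12\min\{L,k\}\le \ell_\infty(S_1,\dots,S_k)\le L$. **Statement.** There are absolute constants $c,c_0>0$ such that for all integers $n$, $k\ge 2$ and $L\ge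 2$ with $c_0\log_2 n\le k\le n$, $$R^{1/3}(\mathrm{MAX}_{n,k,L})\;\ge\; c\,\frac{\min\{L,k\}\,n}{\log_2 k}\qquad\text{and}\qquad R^{1/3}(\mathrm{VAL}_{n,k,L})\;\ge\; c\,\frac{\min\{L,k\}\,n}{\log_2 k}.$$ In particular ($L=k$), finding an element of maximum frequency among arbitrary sets $S_1,\dots,S_k\subseteq[n]$ requires $\Omega(kn/\log k)$ bits of randomized communication. -/

import Mathlib

open scoped ENNReal
open MeasureTheory

/-- One transmitted bit: who sent it, who received it, and its value. -/
structure Message (k : ℕ) where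
  sender : Fin k
  receiver : Fin k
  bit : Bool

/-- What happens next in a protocol: either site `i` sends one bit to site `j`,
or the communication is over and site `i` reports the answer. -/
inductive NextStep (k : ℕ) where
  | send (i j : Fin k)
  | report (i : Fin k)

/-- The part of a transcript that site `i` sees: the bits it has sent or received. -/
def view {k : ℕ} (i : Fin k) (h : List (Message k)) : List (Message k) :=
  h.filter fun m => decide (m.sender = i) || decide (m.receiver = i)

/-- A deterministic protocol for `k` sites in the message-passing model, with local inputs in `X`
and answers in `Y`. The transcript (the list of all bits sent so far, in order) specifies who speaks
next and to whom. Communication is point-to-point: the bit that site `i` sends depends only on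
its own input and on the bits that it has itself sent or received, and so does the answer it may
report. A message of several bits is a run of several steps. -/
structure Protocol (k : ℕ) (X Y : Type) where
  next : List (Message k) → NextStep k
  next_ne : ∀ h i j, next h = NextStep.send i j → i ≠ j
  bit : (i j : Fin k) → X → List (Message k) → Bool
  answer : Fin k → X → List (Message k) → Y

namespace Protocol

variable {k : ℕ} {X Y : Type}

/-- The transcript after at most `t` bits on the input `x`. -/
def transcript (P : Protocol k X Y) (x : Fin k → X) : ℕ → List (Message k)
  | 0 => []
  | t + 1 =>
    let h := P.transcript x t
    match P.next h with
    | NextStep.send i j => h ++ [⟨i, j, P.bit i j (x i) (view i h)⟩]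
    | NextStep.report _ => h

/-- On the input `x` the protocol terminates after at most `C` bits in total. -/
def UsesAtMost (P : Protocol k X Y) (x : Fin k → X) (C : ℕ) : Prop :=
  ∃ i, P.next (P.transcript x C) = NextStep.report i

/-- On the input `x` the protocol terminates, and the answer reported is `y`. -/
def Outputs (P : Protocol k X Y) (x : Fin k → X) (y : Y) : Prop :=
  ∃ t i, P.next (P.transcript x t) = NextStep.report i ∧
    P.answer i (x i) (view i (P.transcript x t)) = y

end Protocol

/-- A communication problem for `k` sites: the admissible inputs, and for each of them the
correct answers. -/
structure CommProblem (k : ℕ) (X Y : Type) where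
  inputs : Set (Fin k → X)
  correct : (Fin k → X) → Y → Prop

/-- A randomized protocol: a family of deterministic protocols indexed by the outcome `ω` of the
random tapes. The law of the tapes is arbitrary, so both private tapes (site `i` uses only its own
component of `ω`) and shared tapes are included. -/
structure RandomizedProtocol (k : ℕ) (X Y : Type) where
  Ω : Type
  mΩ : MeasurableSpace Ω
  law : @Measure Ω mΩ
  isProb : @IsProbabilityMeasure Ω mΩ law
  run : Ω → Protocol k X Y

/-- On every admissible input, the probability over the tapes that the protocol fails to output a
correct answer is at most `δ`. -/
def RandomizedProtocol.Solves {k : ℕ} {X Y : Type} (P : RandomizedProtocol k X Y)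
    (F : CommProblem k X Y) (δ : ℝ≥0∞) : Prop :=
  ∀ x ∈ F.inputs, P.law {ω | ¬ ∃ y, (P.run ω).Outputs x y ∧ F.correct x y} ≤ δ

/-- The protocol uses at most `C` bits on all admissible inputs and all outcomes of the tapes. -/
def RandomizedProtocol.CostAtMost {k : ℕ} {X Y : Type} (P : RandomizedProtocol k X Y)
    (F : CommProblem k X Y) (C : ℕ) : Prop :=
  ∀ x ∈ F.inputs, ∀ ω, (P.run ω).UsesAtMost x C

/-- The randomized `δ`-error communication complexity `R^δ(F)`, in bits. -/
noncomputable def randomizedCC {k : ℕ} {X Y : Type} (δ : ℝ≥0∞) (F : CommProblem k X Y) : ℕ∞ :=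
  ⨅ (C : ℕ) (_ : ∃ P : RandomizedProtocol k X Y, P.Solves F δ ∧ P.CostAtMost F C), (C : ℕ∞)

/-- The frequency of the element `a`: the number of sites whose set contains `a`. -/
def freq {n k : ℕ} (S : Fin k → Finset (Fin n)) (a : Fin n) : ℕ :=
  (Finset.univ.filter fun i => a ∈ S i).card

/-- The maximum frequency `ℓ_∞` of an element. -/
def maxFreq {n k : ℕ} (S : Fin k → Finset (Fin n)) : ℕ :=
  Finset.univ.sup (freq S)

/-- Inputs of maximum frequency `Θ(min {L, k})`: at most `L`, at least half of `min {L, k}`.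
(The maximum frequency is never more than `k`.) -/
def maxFreqInputs (n k L : ℕ) : Set (Fin k → Finset (Fin n)) :=
  {S | maxFreq S ≤ L ∧ min L k ≤ 2 * maxFreq S}

/-- Find an element of the union of the sets that has the maximum frequency. -/
def findMaxFreqElement (n k L : ℕ) : CommProblem k (Finset (Fin n)) (Fin n) where
  inputs := maxFreqInputs n k L
  correct S a := (∃ i, a ∈ S i) ∧ freq S a = maxFreq S

/-- Compute the maximum frequency. -/
def computeMaxFreq (n k L : ℕ) : CommProblem k (Finset (Fin n)) ℕ where
  inputs := maxFreqInputs n k L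
  correct S v := v = maxFreq S

/-! View an input as `n` columns, the sets of sites holding each element. Draw the columns
independently with weights `colWt`, so of size `t` or `t + 1`, where `t + 1` is about half of `min L
k`, and plant one column of size `t + 1` or `t + 2`. A correct protocol must behave differently in
the two cases.

Fix a site `a` and regard all other sites as one player. The column law is a mixture over pairs `(A,
b)` of a fair choice between `A` and `A ∪ {b}` (`sum_splitWt_fiber`). For `b ≠ a` the columns `A`,
`A ∪ {b}`, `A ∪ {a}`, `A ∪ {a, b}` are the four inputs of a two-party AND. Runs have the rectangle
property (`outcome_update_eq`), so by cut-and-paste (`sq_coinProb_sub_le`) the last two columns with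
`b` are told apart only if the view of `a` has different laws at `A` and `A ∪ {b}`, or at `A` and `A
∪ {a}`. Each such difference is information about one fair coin of the mixture, and information
about independent coins adds up to at most the length of any code for the view
(`sum_hellingerSq_le_code`). The pair `(A, a)` has `t + 1` times the weight of `(A, b)` but serves
up to `k` choices of `b`, so the view of `a` costs of order `(t + 1) / k` per element
(`code_length_lower_bound`), and all views together cost of order `(t + 1) n`.

Conversely, with `C` bits sent, all views together have a code of length `O(C log k)` plus lower
order terms: every bit enters two views, and recording its sender and receiver costs `O(log k)`
(`sum_neg_log_siteCode_le`). This is where the factor `log k` is lost.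

For the value, the gap between the planted cases follows from the error bound. For the element, the
answer `j` is forced when size `t + 2` is planted at `j`, but is rare for size `t + 1`, because
distinct answers are disjoint events (`sum_acceptProb_le`). -/

/-! ### Hellinger distance and cut-and-paste -/

/-- The squared Hellinger distance (up to the factor `2`) of two weight functions on `R`. -/
noncomputable def hellingerSq {β : Type*} (R : Finset β) (p q : β → ℝ) : ℝ :=
  ∑ w ∈ R, (√(p w) - √(q w)) ^ 2

theorem hellingerSq_nonneg {β : Type*} (R : Finset β) (p q : β → ℝ) :
    0 ≤ hellingerSq R p q :=
  Finset.sum_nonneg fun _ _ => sq_nonneg _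

/-- Cauchy–Schwarz applied to `|p - q| = |√p - √q| (√p + √q)`. -/
theorem sq_sum_abs_sub_le_hellingerSq {β : Type*} (R : Finset β) {p q : β → ℝ}
    (hp : ∀ w ∈ R, 0 ≤ p w) (hq : ∀ w ∈ R, 0 ≤ q w)
    (hp1 : ∑ w ∈ R, p w ≤ 1) (hq1 : ∑ w ∈ R, q w ≤ 1) :
    (∑ w ∈ R, |p w - q w|) ^ 2 ≤ 4 * hellingerSq R p q := by
  have h1 : ∑ w ∈ R, |p w - q w| = ∑ w ∈ R, |√(p w) - √(q w)| * (√(p w) + √(q w)) := by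
    refine Finset.sum_congr rfl fun w hw => ?_
    rw [← abs_of_nonneg (by positivity : 0 ≤ √(p w) + √(q w)), ← abs_mul]
    congr 1
    nlinarith [Real.sq_sqrt (hp w hw), Real.sq_sqrt (hq w hw)]
  have h2 := Finset.sum_mul_sq_le_sq_mul_sq R (fun w => |√(p w) - √(q w)|)
    (fun w => √(p w) + √(q w))
  have h3 : ∑ w ∈ R, (√(p w) + √(q w)) ^ 2 ≤ 4 := by
    calc ∑ w ∈ R, (√(p w) + √(q w)) ^ 2 ≤ ∑ w ∈ R, (2 * p w + 2 * q w) := by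
          refine Finset.sum_le_sum fun w hw => ?_
          nlinarith [Real.sq_sqrt (hp w hw), Real.sq_sqrt (hq w hw),
            sq_nonneg (√(p w) - √(q w))]
      _ ≤ 4 := by
          rw [Finset.sum_add_distrib, ← Finset.mul_sum, ← Finset.mul_sum]; linarith
  rw [h1]
  refine h2.trans ?_
  simp only [sq_abs]
  rw [mul_comm]
  exact mul_le_mul_of_nonneg_right h3 (hellingerSq_nonneg R p q)

/-- The cut-and-paste argument for the two-party AND function: if the laws of a transcript on the
four inputs factorize, then the acceptance probabilities on `11` and `01` can differ only
if the transcript tells apart `00` from `01` or `00` from `10`. -/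
theorem sq_sum_sub_le_of_cut_paste {β : Type*} (R : Finset β) {p00 p01 p10 p11 r r' : β → ℝ}
    (h00 : ∀ w ∈ R, 0 ≤ p00 w) (h01 : ∀ w ∈ R, 0 ≤ p01 w)
    (h10 : ∀ w ∈ R, 0 ≤ p10 w) (h11 : ∀ w ∈ R, 0 ≤ p11 w)
    (s01 : ∑ w ∈ R, p01 w ≤ 1) (s11 : ∑ w ∈ R, p11 w ≤ 1)
    (s00 : ∑ w ∈ R, p00 w = ∑ w ∈ R, p01 w) (s10 : ∑ w ∈ R, p10 w = ∑ w ∈ R, p11 w)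
    (hcut : ∀ w ∈ R, p00 w * p11 w = p01 w * p10 w)
    (hr : ∀ w ∈ R, 0 ≤ r w) (hr' : ∀ w ∈ R, 0 ≤ r' w)
    (hrp : ∀ w ∈ R, r w ≤ p11 w) (hrp' : ∀ w ∈ R, r' w ≤ p01 w)
    (hrr : ∀ w ∈ R, r w * p01 w = r' w * p11 w) :
    (∑ w ∈ R, r w - ∑ w ∈ R, r' w) ^ 2
      ≤ 24 * (hellingerSq R p00 p01 + hellingerSq R p00 p10) := by
  have key : |∑ w ∈ R, r w - ∑ w ∈ R, r' w| ≤ ∑ w ∈ R, |p11 w - p01 w| := by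
    rw [← Finset.sum_sub_distrib]
    refine (Finset.abs_sum_le_sum_abs _ _).trans (Finset.sum_le_sum fun w hw => ?_)
    -- By `hrr` the ratios `r / p11` and `r' / p01` agree where both make sense, so acceptance
    -- differs by at most the difference of the laws; a vanishing `p11` is treated apart.
    rcases (h11 w hw).eq_or_lt with h0 | hpos
    · have : r w = 0 := le_antisymm (h0 ▸ hrp w hw) (hr w hw)
      rw [this, ← h0, zero_sub, zero_sub, abs_neg, abs_neg, abs_of_nonneg (hr' w hw),
        abs_of_nonneg (h01 w hw)]
      exact hrp' w hw
    · have e : (r w - r' w) * p11 w = r w * (p11 w - p01 w) := by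
        linear_combination hrr w hw
      have e2 : |r w - r' w| * p11 w = r w * |p11 w - p01 w| := by
        rw [← abs_of_pos hpos, ← abs_mul, abs_of_pos hpos, e, abs_mul, abs_of_nonneg (hr w hw)]
      nlinarith [hrp w hw, abs_nonneg (p11 w - p01 w)]
  have h2 := sq_sum_abs_sub_le_hellingerSq R h11 h01 s11 s01
  -- Expanding the squares leaves the total masses and the sums of `√(p q)`. The former agree by
  -- `s00` and `s10`, the latter by `hcut`.
  have hsame : hellingerSq R p00 p11 = hellingerSq R p01 p10 := by
    have expand : ∀ p q : β → ℝ, (∀ w ∈ R, 0 ≤ p w) → (∀ w ∈ R, 0 ≤ q w) →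
        hellingerSq R p q = ∑ w ∈ R, p w + ∑ w ∈ R, q w - 2 * ∑ w ∈ R, √(p w * q w) := by
      intro p q hp hq
      rw [hellingerSq, Finset.mul_sum, ← Finset.sum_add_distrib, ← Finset.sum_sub_distrib]
      refine Finset.sum_congr rfl fun w hw => ?_
      rw [Real.sqrt_mul (hp w hw)]
      nlinarith [Real.sq_sqrt (hp w hw), Real.sq_sqrt (hq w hw)]
    have hs : ∑ w ∈ R, √(p00 w * p11 w) = ∑ w ∈ R, √(p01 w * p10 w) :=
      Finset.sum_congr rfl fun w hw => by rw [hcut w hw]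
    rw [expand _ _ h00 h11, expand _ _ h01 h10, s00, s10, hs]
  have tri : ∀ p q u : β → ℝ,
      hellingerSq R p u ≤ 2 * hellingerSq R p q + 2 * hellingerSq R q u := by
    intro p q u
    simp only [hellingerSq, Finset.mul_sum, ← Finset.sum_add_distrib]
    refine Finset.sum_le_sum fun w _ => ?_
    nlinarith [sq_nonneg ((√(p w) - √(q w)) - (√(q w) - √(u w)))]
  have comm : ∀ p q : β → ℝ, hellingerSq R p q = hellingerSq R q p := by
    intro p q
    exact Finset.sum_congr rfl fun w _ => by ring
  -- If `x`, `y` are the distances of `00` from `01` and from `10`, these bounds give at most `6x +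
  -- 4y` between `11` and `01`; four times this is at most `24 (x + y)`.
  have t1 := tri p11 p00 p01
  have t2 := tri p01 p00 p10
  rw [comm p11 p00, hsame] at t1
  rw [comm p01 p00] at t2
  have h4 : (∑ w ∈ R, r w - ∑ w ∈ R, r' w) ^ 2 ≤ (∑ w ∈ R, |p11 w - p01 w|) ^ 2 :=
    sq_le_sq.mpr (key.trans (le_abs_self _))
  have := hellingerSq_nonneg R p00 p10
  linarith

/-! ### Fair coins and the information a message carries about them -/

open scoped Classical in
/-- The probability of the event `E` for `n` independent fair coins. -/
noncomputable def coinProb {n : ℕ} (E : (Fin n → Bool) → Prop) : ℝ :=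
  (Finset.univ.filter E).card / 2 ^ n

theorem coinProb_nonneg {n : ℕ} (E : (Fin n → Bool) → Prop) : 0 ≤ coinProb E := by
  unfold coinProb; positivity

theorem coinProb_mono {n : ℕ} {E E' : (Fin n → Bool) → Prop} (h : ∀ z, E z → E' z) :
    coinProb E ≤ coinProb E' := by
  classical
  unfold coinProb
  gcongr with z
  exact h z

theorem coinProb_eq_sum {n : ℕ} (E : (Fin n → Bool) → Prop) [DecidablePred E] :
    coinProb E = (∑ z, if E z then (1 : ℝ) else 0) / 2 ^ n := by
  unfold coinProb
  rw [Finset.sum_boole]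
  congr!

theorem sum_coinProb_and_eq {n : ℕ} {β : Type*} (W : (Fin n → Bool) → β) (R : Finset β)
    (hR : ∀ z, W z ∈ R) (E : (Fin n → Bool) → Prop) :
    ∑ w ∈ R, coinProb (fun z => W z = w ∧ E z) = coinProb E := by
  classical
  unfold coinProb
  rw [← Finset.sum_div, ← Nat.cast_sum]
  congr 2
  rw [Finset.card_eq_sum_card_fiberwise (f := W) (t := R) (fun z _ => hR z)]
  refine Finset.sum_congr rfl fun w _ => ?_
  rw [Finset.filter_filter]
  congr 1
  ext z; simp [and_comm]

theorem sum_coinProb_eq_one {n : ℕ} {β : Type*} (W : (Fin n → Bool) → β) (R : Finset β)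
    (hR : ∀ z, W z ∈ R) : ∑ w ∈ R, coinProb (fun z => W z = w) = 1 := by
  have h := sum_coinProb_and_eq W R hR (fun _ => True)
  simp only [and_true] at h
  rw [h]
  simp [coinProb]

/-- Exchanging the coins outside a set `J` between two independent copies. -/
theorem coinProb_mul_eq_of_mix {n : ℕ} (J : Finset (Fin n)) {E F G H : (Fin n → Bool) → Prop}
    (h : ∀ z z', E z ∧ F z' ↔ G (J.piecewise z z') ∧ H (J.piecewise z' z)) :
    coinProb E * coinProb F = coinProb G * coinProb H := by
  classical
  unfold coinProb
  rw [div_mul_div_comm, div_mul_div_comm, ← Nat.cast_mul, ← Nat.cast_mul, ← Finset.card_product,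
    ← Finset.card_product]
  congr 2
  have inv : ∀ u v : Fin n → Bool,
      J.piecewise (J.piecewise u v) (J.piecewise v u) = u := by
    intro u v; ext i; by_cases hi : i ∈ J <;> simp [hi]
  refine Finset.card_nbij' (fun q => (J.piecewise q.1 q.2, J.piecewise q.2 q.1))
    (fun q => (J.piecewise q.1 q.2, J.piecewise q.2 q.1)) ?_ ?_ ?_ ?_
  · rintro ⟨z, z'⟩ hz
    simpa using (h z z').1 (by simpa using hz)
  · rintro ⟨z, z'⟩ hz
    have := (h (J.piecewise z z') (J.piecewise z' z)).2
    rw [inv, inv] at this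
    simpa using this (by simpa using hz)
  · rintro ⟨z, z'⟩ _
    simp [inv]
  · rintro ⟨z, z'⟩ _
    simp [inv]

theorem coinProb_eq_add_coord {n : ℕ} (E : (Fin n → Bool) → Prop) (j : Fin n) (c : Bool) :
    coinProb E = coinProb (fun z => E z ∧ z j = c) + coinProb (fun z => E z ∧ z j = !c) := by
  classical
  rw [coinProb_eq_sum, coinProb_eq_sum, coinProb_eq_sum, ← add_div, ← Finset.sum_add_distrib]
  congr 1
  refine Finset.sum_congr rfl fun z _ => ?_
  by_cases hE : E z <;> cases h : z j <;> cases c <;> simp [hE]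

/-- Overwriting coin `j` is two-to-one onto the outcomes with `z j = c`, so it realizes conditioning
on that coin. -/
theorem coinProb_and_coord_eq {n : ℕ} (E : (Fin n → Bool) → Prop) (j : Fin n) (c : Bool) :
    coinProb (fun z => E (Function.update z j c)) = 2 * coinProb (fun z => E z ∧ z j = c) := by
  classical
  have hflip : coinProb (fun z => E (Function.update z j c) ∧ z j = !c)
      = coinProb (fun z => E (Function.update z j c) ∧ z j = c) := by
    unfold coinProb
    congr 2
    refine Finset.card_nbij' (fun z => Function.update z j c) (fun z => Function.update z j !c)
      ?_ ?_ ?_ ?_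
    · intro z hz
      simpa using And.left (by simpa using hz)
    · intro z hz
      simpa using And.left (by simpa using hz)
    · intro z hz
      have h := And.right (by simpa using hz : _ ∧ z j = !c)
      simp [← h]
    · intro z hz
      have h := And.right (by simpa using hz : _ ∧ z j = c)
      simp [← h]
  rw [coinProb_eq_add_coord _ j c, hflip, ← two_mul]
  congr 2
  funext z
  refine propext ⟨fun ⟨h, h'⟩ => ⟨?_, h'⟩, fun ⟨h, h'⟩ => ⟨?_, h'⟩⟩
  · rwa [← h', Function.update_eq_self] at h
  · rwa [← h', Function.update_eq_self]

theorem sum_comp_div_eq_sum_coinProb {n : ℕ} {β : Type*} (W : (Fin n → Bool) → β) (R : Finset β)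
    (hR : ∀ z, W z ∈ R) (f : β → ℝ) :
    (∑ z, f (W z)) / 2 ^ n = ∑ w ∈ R, coinProb (fun z => W z = w) * f w := by
  classical
  rw [← Finset.sum_fiberwise_of_maps_to (g := W) (t := R) (fun z _ => hR z), Finset.sum_div]
  refine Finset.sum_congr rfl fun w _ => ?_
  rw [Finset.sum_congr rfl (g := fun _ => f w) fun z hz => by rw [(Finset.mem_filter.1 hz).2]]
  rw [Finset.sum_const, nsmul_eq_mul, coinProb]
  rw [mul_div_right_comm]

/-- The information that a message `W z` carries about the independent fair coins `z` is
superadditive over the coins; `Q` is any code. -/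
theorem sum_hellingerSq_le_code {n : ℕ} {β : Type*} (W : (Fin n → Bool) → β) (R : Finset β)
    (hR : ∀ z, W z ∈ R) (Q : β → ℝ) (hQ : ∀ w ∈ R, 0 < Q w) (hQ1 : ∑ w ∈ R, Q w ≤ 1) :
    1 / 4 * ∑ j, hellingerSq R (fun w => coinProb fun z => W (Function.update z j false) = w)
        (fun w => coinProb fun z => W (Function.update z j true) = w)
      ≤ (∑ z, -Real.log (Q (W z))) / 2 ^ n := by
  classical
  set p : β → ℝ := fun w => coinProb fun z => W z = w with hp
  set l : Fin n → Bool → β → ℝ :=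
    fun j c w => coinProb fun z => W (Function.update z j c) = w with hl
  have hl2 : ∀ j c w, l j c w = 2 * coinProb (fun z => W z = w ∧ z j = c) := fun j c w =>
    coinProb_and_coord_eq (fun z => W z = w) j c
  have hlp : ∀ j w, l j true w + l j false w = 2 * p w := by
    intro j w
    rw [hl2, hl2, ← mul_add]
    exact congrArg _ (coinProb_eq_add_coord (fun z => W z = w) j true).symm
  have hl0 : ∀ j c w, 0 ≤ l j c w := fun j c w => coinProb_nonneg _
  have hp0 : ∀ w, 0 ≤ p w := fun w => coinProb_nonneg _
  have hcp : ∀ (E : (Fin n → Bool) → Prop) z, E z → 0 < coinProb E := by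
    intro E z hz
    unfold coinProb
    have : 0 < (Finset.univ.filter E).card := Finset.card_pos.2 ⟨z, by simpa using hz⟩
    positivity
  have hpz : ∀ z, 0 < p (W z) := fun z => hcp _ z rfl
  have hlz : ∀ j z, 0 < l j (z j) (W z) := fun j z =>
    hcp _ z (by rw [Function.update_eq_self])
  have two_pos : (0 : ℝ) < 2 ^ n := by positivity
  -- Gibbs' inequality. Given `W = w`, the ratio `l j c w / p w` is twice the posterior probability
  -- of `z j = c`; the product of these posteriors, weighted by `Q`, has total mass at most `1`.
  have gibbs : ∑ z, (Real.log (Q (W z)) + ∑ j, Real.log (l j (z j) (W z) / p (W z))) ≤ 0 := by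
    have step : ∀ z, Real.log (Q (W z)) + ∑ j, Real.log (l j (z j) (W z) / p (W z))
        ≤ Q (W z) * ∏ j, (l j (z j) (W z) / p (W z)) - 1 := by
      intro z
      have hprod : 0 < ∏ j, (l j (z j) (W z) / p (W z)) :=
        Finset.prod_pos fun j _ => div_pos (hlz j z) (hpz z)
      rw [← Real.log_prod (fun j _ => (div_pos (hlz j z) (hpz z)).ne'),
        ← Real.log_mul (hQ _ (hR z)).ne' hprod.ne']
      exact Real.log_le_sub_one_of_pos (mul_pos (hQ _ (hR z)) hprod)
    refine (Finset.sum_le_sum fun z _ => step z).trans ?_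
    rw [Finset.sum_sub_distrib]
    have hone : ∑ _z : Fin n → Bool, (1 : ℝ) = 2 ^ n := by simp
    rw [hone, sub_nonpos]
    calc ∑ z, Q (W z) * ∏ j, (l j (z j) (W z) / p (W z))
        = ∑ w ∈ R, ∑ z with W z = w, Q (W z) * ∏ j, (l j (z j) (W z) / p (W z)) :=
          (Finset.sum_fiberwise_of_maps_to (g := W) (fun z _ => hR z) _).symm
      _ ≤ ∑ w ∈ R, Q w * 2 ^ n := by
          refine Finset.sum_le_sum fun w hw => ?_
          calc ∑ z with W z = w, Q (W z) * ∏ j, (l j (z j) (W z) / p (W z))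
              = ∑ z with W z = w, Q w * ∏ j, (l j (z j) w / p w) :=
                Finset.sum_congr rfl fun z hz => by rw [(Finset.mem_filter.1 hz).2]
            _ ≤ ∑ z : Fin n → Bool, Q w * ∏ j, (l j (z j) w / p w) := by
                refine Finset.sum_le_sum_of_subset_of_nonneg (Finset.filter_subset _ _) ?_
                intro z _ _
                exact mul_nonneg (hQ w hw).le
                  (Finset.prod_nonneg fun j _ => div_nonneg (hl0 _ _ _) (hp0 _))
            _ = Q w * ∏ j : Fin n, ∑ c : Bool, (l j c w / p w) := by
                rw [← Finset.mul_sum, Finset.prod_univ_sum, Fintype.piFinset_univ]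
            _ ≤ Q w * ∏ j : Fin n, 2 := by
                refine mul_le_mul_of_nonneg_left (Finset.prod_le_prod ?_ ?_) (hQ w hw).le
                · intro j _
                  exact Finset.sum_nonneg fun c _ => div_nonneg (hl0 _ _ _) (hp0 _)
                · intro j _
                  rw [Fintype.sum_bool, ← add_div, hlp]
                  rcases (hp0 w).eq_or_lt with h0 | h0
                  · rw [← h0]; norm_num
                  · rw [mul_div_assoc, div_self h0.ne']; norm_num
            _ = Q w * 2 ^ n := by simp
      _ ≤ 2 ^ n := by
          rw [← Finset.sum_mul]
          exact mul_le_of_le_one_left two_pos.le hQ1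
  have logb : ∀ j, 1 / 4 * hellingerSq R (l j false) (l j true)
      ≤ (∑ z, Real.log (l j (z j) (W z) / p (W z))) / 2 ^ n := by
    intro j
    -- The bound `log u ≥ 2 (1 - 1 / √u)` passes from relative entropy to Hellinger affinity.
    have h1 : ∀ z, 2 * (1 - √(p (W z) / l j (z j) (W z)))
        ≤ Real.log (l j (z j) (W z) / p (W z)) := by
      intro z
      have hx : 0 < p (W z) / l j (z j) (W z) := div_pos (hpz z) (hlz j z)
      have h2 := Real.log_le_sub_one_of_pos (Real.sqrt_pos.2 hx)
      rw [Real.log_sqrt hx.le] at h2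
      rw [← inv_div (p (W z)), Real.log_inv]
      linarith
    have h2 : (∑ z, 2 * (1 - √(p (W z) / l j (z j) (W z)))) / 2 ^ n
        = ∑ w ∈ R, ∑ c : Bool, (l j c w - √(l j c w * p w)) := by
      have h3 := sum_comp_div_eq_sum_coinProb (fun z => (W z, z j)) (R ×ˢ Finset.univ)
        (fun z => by simp [hR z]) (fun q => 2 * (1 - √(p q.1 / l j q.2 q.1)))
      simp only at h3
      rw [h3, Finset.sum_product]
      refine Finset.sum_congr rfl fun w _ => Finset.sum_congr rfl fun c _ => ?_
      simp only [Prod.mk.injEq]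
      have h4 : √(l j c w * p w) = l j c w * √(p w / l j c w) := by
        rcases (hl0 j c w).eq_or_lt with h0 | h0
        · rw [← h0]; simp
        · rw [show l j c w * p w = l j c w ^ 2 * (p w / l j c w) by field_simp,
            Real.sqrt_mul (sq_nonneg _), Real.sqrt_sq h0.le]
      rw [h4, hl2 j c w]; ring
    calc 1 / 4 * hellingerSq R (l j false) (l j true)
        ≤ ∑ w ∈ R, ∑ c : Bool, (l j c w - √(l j c w * p w)) := by
          rw [hellingerSq, Finset.mul_sum]
          refine Finset.sum_le_sum fun w _ => ?_
          rw [Fintype.sum_bool, Real.sqrt_mul (hl0 _ _ _), Real.sqrt_mul (hl0 _ _ _)]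
          -- Since `p` is the mean of the two conditional laws, with `s` the mean of their square
          -- roots the left side is `p - s²`; the right side `2p - 2s√p` exceeds it by `(√p - s)²`.
          have e := hlp j w
          nlinarith [Real.sq_sqrt (hl0 j true w), Real.sq_sqrt (hl0 j false w),
            Real.sq_sqrt (hp0 w),
            sq_nonneg (√(p w) - (√(l j true w) + √(l j false w)) / 2)]
      _ = (∑ z, 2 * (1 - √(p (W z) / l j (z j) (W z)))) / 2 ^ n := h2.symm
      _ ≤ _ := by
          gcongr with z
          exact h1 z
  rw [Finset.mul_sum]
  refine (Finset.sum_le_sum fun j _ => logb j).trans ?_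
  rw [← Finset.sum_div]
  gcongr
  rw [Finset.sum_add_distrib] at gibbs
  rw [Finset.sum_neg_distrib, Finset.sum_comm]
  linarith

/-! ### Transcripts, local views and the rectangle property -/

theorem List.filter_append_singleton {α : Type*} (f : α → Bool) {l : List α} {m : α} :
    (l ++ [m]).filter f = if f m then l.filter f ++ [m] else l.filter f := by
  rw [List.filter_append]
  by_cases h : f m <;> simp [h]

namespace Protocol

variable {k : ℕ} {X Y T : Type} (P : Protocol k X Y) (C : ℕ) (τ : Y → T)

theorem transcript_succ (x : Fin k → X) (t : ℕ) : P.transcript x (t + 1) =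
    match P.next (P.transcript x t) with
    | NextStep.send i j => P.transcript x t ++ [⟨i, j, P.bit i j (x i) (view i (P.transcript x t))⟩]
    | NextStep.report _ => P.transcript x t := rfl

theorem transcript_prefix_succ (x : Fin k → X) (t : ℕ) :
    P.transcript x t <+: P.transcript x (t + 1) := by
  rw [transcript_succ]
  cases P.next (P.transcript x t) <;> simp

theorem transcript_prefix (x : Fin k → X) {s t : ℕ} (h : s ≤ t) :
    P.transcript x s <+: P.transcript x t := by
  induction t, h using Nat.le_induction with
  | base => exact List.prefix_refl _
  | succ t _ ih => exact ih.trans (P.transcript_prefix_succ x t)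

theorem length_transcript_le (x : Fin k → X) (t : ℕ) : (P.transcript x t).length ≤ t := by
  induction t with
  | zero => simp [transcript]
  | succ t ih =>
    rw [transcript_succ]
    cases P.next (P.transcript x t)
    · simpa using ih
    · exact ih.trans (Nat.le_succ t)

theorem transcript_eq_of_report (x : Fin k → X) {s t : ℕ} (h : s ≤ t) {i : Fin k}
    (hs : P.next (P.transcript x s) = NextStep.report i) :
    P.transcript x t = P.transcript x s := by
  induction t, h using Nat.le_induction with
  | base => rfl
  | succ t _ ih => rw [transcript_succ, ih, hs]

/-- The bits sent by site `a` in the transcript are the ones its input dictates. -/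
theorem bit_eq_of_prefix_view (x : Fin k → X) (a : Fin k) (t : ℕ) {v : List (Message k)}
    {m : Message k} (h : v ++ [m] <+: view a (P.transcript x t)) (hm : m.sender = a) :
    m.bit = P.bit a m.receiver (x a) v := by
  induction t with
  | zero => simp [transcript, view] at h
  | succ t ih =>
    rw [transcript_succ] at h
    cases hn : P.next (P.transcript x t) with
    | report i => rw [hn] at h; exact ih h
    | send i j =>
      rw [hn] at h
      simp only [view] at h
      rw [List.filter_append_singleton] at h
      split_ifs at h with hi
      · rcases List.prefix_concat_iff.1 h with h | h
        · have h' := List.append_inj h (by simpa using congrArg List.length h)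
          obtain ⟨h1, h2⟩ := h'
          simp only [List.cons.injEq, and_true] at h2
          subst h2
          simp only at hm
          subst hm
          rw [h1]
        · exact ih h
      · exact ih h

/-- If two inputs give site `a` the same view, replacing the input of `a` in the second by its
input in the first does not change the transcript. -/
theorem transcript_update_eq (x y : Fin k → X) (a : Fin k)
    (h : view a (P.transcript x C) = view a (P.transcript y C)) {t : ℕ} (ht : t ≤ C) :
    P.transcript (Function.update y a (x a)) t = P.transcript y t := by
  induction t with
  | zero => rfl
  | succ t ih =>
    have ih := ih (Nat.le_of_succ_le ht)
    have hpre := P.transcript_prefix y ht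
    rw [transcript_succ] at hpre
    rw [transcript_succ, transcript_succ, ih]
    cases hn : P.next (P.transcript y t) with
    | report i => rfl
    | send i j =>
      rw [hn] at hpre
      simp only at hpre
      by_cases hi : i = a
      · subst hi
        -- What `i` sends on `y` lies in the view common to both runs, so the input `x i` dictates
        -- the same bit.
        have hv : view i (P.transcript y t) ++
            [⟨i, j, P.bit i j (y i) (view i (P.transcript y t))⟩]
              <+: view i (P.transcript x C) := by
          rw [h]
          have := hpre.filter (fun m => decide (m.sender = i) || decide (m.receiver = i))
          rw [List.filter_append_singleton] at this
          simpa [view] using this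
        have hb := P.bit_eq_of_prefix_view x i C hv rfl
        simp only at hb
        simp [hb]
      · simp [hi]

/-- What the protocol has reported after at most `C` bits, if anything. -/
def outcome (x : Fin k → X) : Option T :=
  match P.next (P.transcript x C) with
  | NextStep.report i => some (τ (P.answer i (x i) (view i (P.transcript x C))))
  | NextStep.send _ _ => none

/-- The answer, if it is reported by site `a`. -/
def outcomeAt (a : Fin k) (x : Fin k → X) : Option T :=
  match P.next (P.transcript x C) with
  | NextStep.report i =>
    if i = a then some (τ (P.answer i (x i) (view i (P.transcript x C)))) else none
  | NextStep.send _ _ => none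

/-- All that site `a` sees of the run, together with the answer if `a` reports it. -/
def localRun (a : Fin k) (x : Fin k → X) : List (Message k) × Option T :=
  (view a (P.transcript x C), P.outcomeAt C τ a x)

/-- The transcript is unchanged by `transcript_update_eq`. If another site reports, its input is
unchanged too; if `a` reports, its answer is part of `localRun`, hence the same for both inputs. -/
theorem outcome_update_eq (x y : Fin k → X) (a : Fin k)
    (h : P.localRun C τ a x = P.localRun C τ a y) :
    P.outcome C τ (Function.update y a (x a)) = P.outcome C τ y ∧
      P.localRun C τ a (Function.update y a (x a)) = P.localRun C τ a y := by
  obtain ⟨h1, h2⟩ := Prod.mk.inj h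
  have htr := P.transcript_update_eq C x y a h1 le_rfl
  simp only [outcomeAt] at h2
  simp only [outcome, localRun, outcomeAt, htr]
  cases hn : P.next (P.transcript y C) with
  | send i j => simp
  | report i =>
    by_cases hi : i = a
    · subst hi
      simp only [hn, if_true] at h2
      cases hx : P.next (P.transcript x C) with
      | send i' j' => rw [hx] at h2; simp at h2
      | report i' =>
        rw [hx] at h2
        by_cases hi' : i' = i
        · subst hi'
          simp only [if_true, h1] at h2
          simp [h2]
        · simp [hi'] at h2
    · simp [hi]

/-- Truncation after `C` bits loses nothing on admissible inputs. It is needed because the averages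
also run over inputs whose maximum frequency may be only `t`, where the cost bound says nothing. -/
theorem outcome_eq_of_outputs {x : Fin k → X} (hC : P.UsesAtMost x C) {y : Y}
    (h : P.Outputs x y) : P.outcome C τ x = some (τ y) := by
  obtain ⟨i, hi⟩ := hC
  obtain ⟨t, i', hi', hy⟩ := h
  have e : P.transcript x t = P.transcript x C := by
    rcases le_total t C with h | h
    · exact (P.transcript_eq_of_report x h hi').symm
    · exact P.transcript_eq_of_report x h hi
  rw [e] at hi' hy
  simp [outcome, hi', hy]

end Protocol

/-! ### Lengths of views and a prefix code for lists -/

/-- Each bit is seen only by its sender and its receiver. -/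
theorem sum_length_view_le {k : ℕ} (h : List (Message k)) :
    ∑ a, (view a h).length ≤ 2 * h.length := by
  induction h with
  | nil => simp [view]
  | cons m h ih =>
    have e : ∀ a, (view a (m :: h)).length ≤
        (view a h).length + ((if m.sender = a then 1 else 0) + if m.receiver = a then 1 else 0) := by
      intro a
      simp only [view, List.filter_cons]
      by_cases h1 : m.sender = a <;> by_cases h2 : m.receiver = a <;> simp [h1, h2]
    refine (Finset.sum_le_sum fun a _ => e a).trans ?_
    rw [Finset.sum_add_distrib, Finset.sum_add_distrib]
    simp only [Finset.sum_ite_eq, Finset.mem_univ, if_true, List.length_cons]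
    omega

/-- A transmitted bit is a sender, a receiver and a value. -/
def messageEquiv (k : ℕ) : Message k ≃ Fin k × Fin k × Bool where
  toFun m := (m.sender, m.receiver, m.bit)
  invFun q := ⟨q.1, q.2.1, q.2.2⟩
  left_inv _ := rfl
  right_inv _ := rfl

instance (k : ℕ) : Fintype (Message k) := Fintype.ofEquiv _ (messageEquiv k).symm

theorem card_message (k : ℕ) : Fintype.card (Message k) = 2 * k ^ 2 := by
  rw [Fintype.card_congr (messageEquiv k)]
  simp; ring

/-- Kraft's inequality for the geometric code on lists. -/
theorem sum_pow_length_le {α : Type*} [Fintype α] (R : Finset (List α)) {θ : ℝ}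
    (h0 : 0 < θ) (h1 : θ < 1) (hα : 0 < Fintype.card α) :
    ∑ l ∈ R, (1 - θ) * (θ / Fintype.card α) ^ l.length ≤ 1 := by
  classical
  set q : ℝ := θ / Fintype.card α with hq
  have hq0 : 0 ≤ q := by positivity
  set N := R.sup List.length
  have hsub : R ⊆ (Finset.range (N + 1)).biUnion
      fun i => Finset.univ.image (List.ofFn : (Fin i → α) → List α) := by
    intro l hl
    refine Finset.mem_biUnion.2 ⟨l.length, ?_, ?_⟩
    · exact Finset.mem_range.2 (Nat.lt_succ_of_le (Finset.le_sup (f := List.length) hl))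
    · exact Finset.mem_image.2 ⟨l.get, Finset.mem_univ _, List.ofFn_get l⟩
  have hterm : ∀ i, ∑ l ∈ Finset.univ.image (List.ofFn : (Fin i → α) → List α), q ^ l.length
      = θ ^ i := by
    intro i
    rw [Finset.sum_image (fun f _ g _ h => List.ofFn_injective h)]
    have : (Fintype.card α : ℝ) ≠ 0 := by positivity
    simp only [List.length_ofFn, Finset.sum_const, Finset.card_univ, Fintype.card_fun,
      Fintype.card_fin, nsmul_eq_mul, Nat.cast_pow, hq]
    rw [← mul_pow, mul_div_cancel₀ _ this]
  rw [← Finset.mul_sum]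
  have hle : ∑ l ∈ R, q ^ l.length ≤ ∑ i ∈ Finset.range (N + 1), θ ^ i := by
    refine (Finset.sum_le_sum_of_subset_of_nonneg hsub fun l _ _ => by positivity).trans ?_
    rw [Finset.sum_biUnion]
    · exact (Finset.sum_congr rfl fun i _ => hterm i).le
    · intro i _ i' _ hne
      refine Finset.disjoint_left.2 fun l hl hl' => hne ?_
      obtain ⟨f, _, rfl⟩ := Finset.mem_image.1 hl
      obtain ⟨g, _, hg⟩ := Finset.mem_image.1 hl'
      simpa using (congrArg List.length hg).symm
  have hgeo : (1 - θ) * ∑ i ∈ Finset.range (N + 1), θ ^ i = 1 - θ ^ (N + 1) := by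
    rw [mul_comm]; exact geom_sum_mul_neg θ (N + 1)
  calc (1 - θ) * ∑ l ∈ R, q ^ l.length
      ≤ (1 - θ) * ∑ i ∈ Finset.range (N + 1), θ ^ i :=
        mul_le_mul_of_nonneg_left hle (by linarith)
    _ ≤ 1 := by rw [hgeo]; have : 0 ≤ θ ^ (N + 1) := by positivity
                linarith

/-! ### The hard distribution of columns and its splitting for each site -/

/-- The weight of a column `B` (the set of sites holding a fixed element). -/
noncomputable def colWt {k : ℕ} (t : ℕ) (B : Finset (Fin k)) : ℝ :=
  if B.card = t then k else if B.card = t + 1 then t + 1 else 0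

/-- The column determined by a pair `(A, b)` and a coin: `A`, or `A` with `b` added. -/
def splitVal {k : ℕ} (d : Finset (Fin k) × Fin k) (c : Bool) : Finset (Fin k) :=
  if c then insert d.2 d.1 else d.1

/-- From the point of view of site `a`, the column weights are a mixture over pairs `(A, b)`
of a fair choice between `A` and `insert b A`. -/
noncomputable def splitWt {k : ℕ} (t : ℕ) (a : Fin k) (d : Finset (Fin k) × Fin k) : ℝ :=
  if d.1.card = t then
    if d.2 = a then (if a ∈ d.1 then k / 2 else t + 1)
    else if a ∉ d.1 ∧ d.2 ∉ d.1 then 1 else 0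
  else 0

noncomputable def totalWt (k t : ℕ) : ℝ := ∑ B : Finset (Fin k), colWt t B

theorem colWt_nonneg {k : ℕ} (t : ℕ) (B : Finset (Fin k)) : 0 ≤ colWt t B := by
  unfold colWt; split_ifs <;> positivity

theorem splitWt_nonneg {k : ℕ} (t : ℕ) (a : Fin k) (d : Finset (Fin k) × Fin k) :
    0 ≤ splitWt t a d := by
  unfold splitWt; split_ifs <;> positivity

/-- For `B` of size `t + 1`: if `a ∈ B`, only `(B \ {a}, a)` contributes, with `t + 1`; otherwise
each of the `t + 1` pairs `(B \ {b}, b)` contributes `1`. For `B` of size `t`: if `a ∉ B`, the pair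
`(B, a)` gives `t + 1` and the `k - t - 1` pairs `(B, b)` with `b` outside `B ∪ {a}` give `1` each;
if `a ∈ B`, both coin values of `(B, a)` produce `B`, giving `k / 2` twice. The same column law thus
serves every site. -/
theorem sum_splitWt_fiber {k : ℕ} (t : ℕ) (a : Fin k) (B : Finset (Fin k)) :
    ∑ d : (Finset (Fin k) × Fin k) × Bool with splitVal d.1 d.2 = B, splitWt t a d.1
      = colWt t B := by
  have hfst : ∑ d : Finset (Fin k) × Fin k, (if d.1 = B then splitWt t a d else 0)
      = ∑ b, splitWt t a (B, b) := by
    rw [Fintype.sum_prod_type, Finset.sum_comm]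
    simp
  have hsnd : ∑ d : Finset (Fin k) × Fin k, (if insert d.2 d.1 = B then splitWt t a d else 0)
      = ∑ b ∈ B, (splitWt t a (B, b) + splitWt t a (B.erase b, b)) := by
    rw [Fintype.sum_prod_type, Finset.sum_comm, ← Finset.sum_filter_add_sum_filter_not _ (· ∈ B)]
    rw [Finset.filter_mem_eq_inter, Finset.univ_inter]
    rw [Finset.sum_eq_zero (s := Finset.univ.filter (· ∉ B)), add_zero]
    · refine Finset.sum_congr rfl fun b hb => ?_
      have hne : B ≠ B.erase b := fun h => by
        have := h ▸ hb; simp at this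
      rw [← Finset.sum_pair (f := fun A => splitWt t a (A, b)) hne, ← Finset.sum_filter]
      refine Finset.sum_congr ?_ fun _ _ => rfl
      ext A
      simp only [Finset.mem_filter, Finset.mem_univ, true_and, Finset.mem_insert,
        Finset.mem_singleton]
      constructor
      · rintro rfl
        by_cases h : b ∈ A
        · left; simp [h]
        · right; simp [h]
      · rintro (rfl | rfl)
        · simp [hb]
        · simp [hb]
    · intro b hb
      refine Finset.sum_eq_zero fun A _ => if_neg ?_
      rintro rfl
      simp at hb
  have key : ∑ d : (Finset (Fin k) × Fin k) × Bool with splitVal d.1 d.2 = B,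
        splitWt t a d.1
      = ∑ b, splitWt t a (B, b) + ∑ b ∈ B, (splitWt t a (B, b) + splitWt t a (B.erase b, b)) := by
    rw [← hfst, ← hsnd, Finset.sum_filter, Fintype.sum_prod_type, ← Finset.sum_add_distrib]
    refine Finset.sum_congr rfl fun d _ => ?_
    rw [Fintype.sum_bool]
    simp [splitVal, add_comm]
  rw [key]
  by_cases ht : B.card = t
  · have h2 : ∀ b ∈ B, splitWt t a (B.erase b, b) = 0 := by
      intro b hb
      have h1 := Finset.card_erase_of_mem hb
      have h3 := Finset.card_pos.2 ⟨b, hb⟩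
      simp only [splitWt]
      rw [if_neg (by omega)]
    rw [Finset.sum_add_distrib, Finset.sum_congr rfl h2]
    by_cases ha : a ∈ B
    · have h4 : ∀ b, splitWt t a (B, b) = if b = a then (k : ℝ) / 2 else 0 := by
        intro b; simp [splitWt, ht, ha]
      simp [h4, ha, colWt, ht]
    · have h4 : ∀ b ∈ B, splitWt t a (B, b) = 0 := by
        intro b hb
        have : b ≠ a := fun h => ha (h ▸ hb)
        simp [splitWt, ht, ha, this, hb]
      have h5 : ∀ b, splitWt t a (B, b)
          = (if b = a then ((t : ℝ) + 1) else 0) + if b ∈ Finset.univ \ insert a B then 1 else 0 := by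
        intro b
        by_cases hb : b = a
        · subst hb; simp [splitWt, ht, ha]
        · simp [splitWt, ht, ha, hb]
      have h6 : ((Finset.univ \ insert a B).card : ℝ) = k - (t + 1) := by
        rw [Finset.card_sdiff_of_subset (Finset.subset_univ _), Finset.card_insert_of_notMem ha,
          ht, Finset.card_univ, Fintype.card_fin, Nat.cast_sub]
        · push_cast; ring
        · rw [← ht, ← Finset.card_insert_of_notMem ha]
          simpa using Finset.card_le_univ (insert a B)
      rw [Finset.sum_congr rfl h4, Finset.sum_congr rfl fun b _ => h5 b, Finset.sum_add_distrib]
      rw [Finset.sum_ite_mem, Finset.univ_inter, Finset.sum_const, nsmul_eq_mul, mul_one, h6]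
      simp [colWt, ht]
  · have h2 : ∀ b, splitWt t a (B, b) = 0 := by
      intro b; simp [splitWt, ht]
    simp only [h2, Finset.sum_const_zero, zero_add]
    by_cases ht' : B.card = t + 1
    · have h3 : ∀ b ∈ B, (B.erase b).card = t := by
        intro b hb
        rw [Finset.card_erase_of_mem hb, ht']; rfl
      have e : colWt t B = t + 1 := by simp [colWt, ht']
      rw [e]
      by_cases ha : a ∈ B
      · rw [Finset.sum_eq_single_of_mem a ha]
        · simp [splitWt, h3 a ha]
        · intro b hb hne
          have : a ∈ B.erase b := Finset.mem_erase.2 ⟨hne.symm, ha⟩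
          simp [splitWt, hne, this]
      · rw [Finset.sum_congr rfl (g := fun _ => (1 : ℝ))]
        · simp [ht']
        · intro b hb
          have : b ≠ a := fun h => ha (h ▸ hb)
          simp [splitWt, h3 b hb, this, ha]
    · rw [Finset.sum_eq_zero]
      · simp [colWt, ht, ht']
      · intro b hb
        have h1 := Finset.card_erase_of_mem hb
        have h3 := Finset.card_pos.2 ⟨b, hb⟩
        simp only [splitWt]
        rw [if_neg (by omega)]

/-- The image of a product measure under a coordinatewise map is the product of the image measures.
-/
theorem sum_prod_comp_eq {ι E β : Type*} [Fintype ι] [Fintype E] [Fintype β] [DecidableEq ι]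
    [DecidableEq β] (v : E → β) (wE : E → ℝ) (m : β → ℝ)
    (h : ∀ B, ∑ e with v e = B, wE e = m B) (F : (ι → β) → ℝ) :
    ∑ e : ι → E, (∏ i, wE (e i)) * F (fun i => v (e i)) = ∑ S : ι → β, (∏ i, m (S i)) * F S := by
  rw [← Finset.sum_fiberwise (g := fun (e : ι → E) i => v (e i))]
  refine Finset.sum_congr rfl fun S _ => ?_
  have e1 : Finset.univ.filter (fun e : ι → E => (fun i => v (e i)) = S)
      = Fintype.piFinset fun i => Finset.univ.filter fun x => v x = S i := by
    ext e; simp [funext_iff]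
  rw [Finset.sum_congr rfl (g := fun e : ι → E => (∏ i, wE (e i)) * F S) fun e he => by
    rw [(Finset.mem_filter.1 he).2], ← Finset.sum_mul, e1]
  congr 1
  rw [← Finset.prod_univ_sum]
  exact Finset.prod_congr rfl fun i _ => h _

/-- The mean over columns drawn independently according to `colWt`. -/
noncomputable def colMean {n k : ℕ} (t : ℕ) (F : (Fin n → Finset (Fin k)) → ℝ) : ℝ :=
  (∑ S, (∏ i, colWt t (S i)) * F S) / totalWt k t ^ n

/-- The mean over pairs drawn independently according to `splitWt`. -/
noncomputable def splitMean {n k : ℕ} (t : ℕ) (a : Fin k)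
    (f : (Fin n → Finset (Fin k) × Fin k) → ℝ) : ℝ :=
  ∑ d, (∏ i, (2 * splitWt t a (d i) / totalWt k t)) * f d

theorem two_mul_sum_splitWt {k : ℕ} (t : ℕ) (a : Fin k) :
    2 * ∑ d, splitWt t a d = totalWt k t := by
  unfold totalWt
  rw [← Finset.sum_congr rfl fun B _ => sum_splitWt_fiber t a B, Finset.sum_fiberwise,
    Finset.mul_sum, Fintype.sum_prod_type (f := fun d : (Finset (Fin k) × Fin k) × Bool => _)]
  simp only [Fintype.sum_bool, two_mul]

theorem colMean_eq_splitMean {n k : ℕ} (t : ℕ) (a : Fin k)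
    (F : (Fin n → Finset (Fin k)) → ℝ) :
    colMean t F = splitMean t a
      (fun d => (∑ z : Fin n → Bool, F fun i => splitVal (d i) (z i)) / 2 ^ n) := by
  unfold colMean splitMean
  rw [← sum_prod_comp_eq (fun d : (Finset (Fin k) × Fin k) × Bool => splitVal d.1 d.2)
    (fun d => splitWt t a d.1) (colWt t) (sum_splitWt_fiber t a) F]
  rw [← (Equiv.arrowProdEquivProdArrow (Fin n) (fun _ => Finset (Fin k) × Fin k)
    (fun _ => Bool)).symm.sum_comp, Fintype.sum_prod_type, Finset.sum_div]
  refine Finset.sum_congr rfl fun d _ => ?_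
  simp only [Equiv.arrowProdEquivProdArrow, Equiv.coe_fn_symm_mk]
  rw [← Finset.mul_sum, Finset.prod_div_distrib, Finset.prod_mul_distrib]
  simp only [Finset.prod_const, Finset.card_univ, Fintype.card_fin]
  field_simp

theorem splitMean_mono {n k : ℕ} (t : ℕ) (a : Fin k) (hM : 0 < totalWt k t)
    {f g : (Fin n → Finset (Fin k) × Fin k) → ℝ} (h : ∀ d, f d ≤ g d) :
    splitMean t a f ≤ splitMean t a g := by
  refine Finset.sum_le_sum fun d _ => mul_le_mul_of_nonneg_left (h d) ?_
  exact Finset.prod_nonneg fun i _ => div_nonneg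
    (mul_nonneg zero_le_two (splitWt_nonneg t a _)) hM.le

theorem sum_normalized_splitWt {k : ℕ} (t : ℕ) (a : Fin k) (hM : 0 < totalWt k t) :
    ∑ d, 2 * splitWt t a d / totalWt k t = 1 := by
  rw [← Finset.sum_div, ← Finset.mul_sum, two_mul_sum_splitWt, div_self hM.ne']

theorem splitMean_const {n k : ℕ} (t : ℕ) (a : Fin k) (hM : 0 < totalWt k t) (c : ℝ) :
    splitMean (n := n) t a (fun _ => c) = c := by
  unfold splitMean
  rw [← Finset.sum_mul]
  have h := Finset.prod_univ_sum (fun _ : Fin n => (Finset.univ : Finset (Finset (Fin k) × Fin k)))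
    (fun _ d => 2 * splitWt t a d / totalWt k t)
  rw [Fintype.piFinset_univ] at h
  rw [← h]
  simp [sum_normalized_splitWt t a hM]

/-- Redrawing one coordinate of a product. -/
theorem sum_prod_resample {n : ℕ} {E : Type*} [Fintype E] (ν : E → ℝ) (j : Fin n)
    (f : (Fin n → E) → ℝ) :
    (∑ e, ν e) * ∑ d, (∏ i, ν (d i)) * f d
      = ∑ d, (∏ i, ν (d i)) * ∑ e, ν e * f (Function.update d j e) := by
  calc (∑ e, ν e) * ∑ d, (∏ i, ν (d i)) * f d
      = ∑ q : (Fin n → E) × E, (∏ i, ν (q.1 i)) * ν q.2 * f q.1 := by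
        rw [Fintype.sum_prod_type, Finset.mul_sum]
        refine Finset.sum_congr rfl fun d _ => ?_
        simp only
        rw [← Finset.sum_mul, ← Finset.mul_sum]
        ring
    _ = ∑ q : (Fin n → E) × E, (∏ i, ν (q.1 i)) * ν q.2 * f (Function.update q.1 j q.2) := by
        refine Finset.sum_nbij' (fun q => (Function.update q.1 j q.2, q.1 j))
          (fun q => (Function.update q.1 j q.2, q.1 j)) (by simp) (by simp) (by simp) (by simp) ?_
        rintro ⟨d, e⟩ _
        simp only [Function.update_idem, Function.update_eq_self]
        congr 1
        rw [← Finset.mul_prod_erase _ _ (Finset.mem_univ j),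
          ← Finset.mul_prod_erase _ (fun i => ν (Function.update d j e i)) (Finset.mem_univ j)]
        rw [Finset.prod_congr rfl (s₁ := Finset.univ.erase j)
          (g := fun i => ν (d i)) (f := fun i => ν (Function.update d j e i)) fun i hi => by
            rw [Function.update_of_ne (Finset.ne_of_mem_erase hi)]]
        rw [Function.update_self]
        ring
    _ = _ := by
        rw [Fintype.sum_prod_type]
        refine Finset.sum_congr rfl fun d _ => ?_
        rw [Finset.mul_sum]
        exact Finset.sum_congr rfl fun e _ => by ring

theorem splitMean_resample {n k : ℕ} (t : ℕ) (a : Fin k) (hM : 0 < totalWt k t) (j : Fin n)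
    (f : (Fin n → Finset (Fin k) × Fin k) → ℝ) :
    splitMean t a f = splitMean t a
      (fun d => ∑ e, 2 * splitWt t a e / totalWt k t * f (Function.update d j e)) := by
  have h := sum_prod_resample (fun e => 2 * splitWt t a e / totalWt k t) j f
  rwa [sum_normalized_splitWt t a hM, one_mul] at h

theorem colMean_resample {n k : ℕ} (t : ℕ) (j : Fin n) (F : (Fin n → Finset (Fin k)) → ℝ) :
    ∑ B, colWt t B * colMean t (fun S => F (Function.update S j B))
      = totalWt k t * colMean t F := by
  have h := sum_prod_resample (colWt t) j F
  unfold colMean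
  rw [← mul_div_assoc, totalWt, h, ← totalWt]
  simp only [Finset.mul_sum, ← mul_div_assoc]
  rw [← Finset.sum_div, Finset.sum_comm]
  congr 1
  exact Finset.sum_congr rfl fun S _ => Finset.sum_congr rfl fun B _ => by ring

theorem splitMean_add {n k : ℕ} (t : ℕ) (a : Fin k)
    (f g : (Fin n → Finset (Fin k) × Fin k) → ℝ) :
    splitMean t a (fun d => f d + g d) = splitMean t a f + splitMean t a g := by
  simp only [splitMean, mul_add, Finset.sum_add_distrib]

theorem splitMean_const_mul {n k : ℕ} (t : ℕ) (a : Fin k) (c : ℝ)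
    (f : (Fin n → Finset (Fin k) × Fin k) → ℝ) :
    splitMean t a (fun d => c * f d) = c * splitMean t a f := by
  simp only [splitMean, Finset.mul_sum]
  exact Finset.sum_congr rfl fun d _ => by ring

theorem splitMean_sum {n k : ℕ} {ι : Type*} (s : Finset ι) (t : ℕ) (a : Fin k)
    (f : ι → (Fin n → Finset (Fin k) × Fin k) → ℝ) :
    splitMean t a (fun d => ∑ i ∈ s, f i d) = ∑ i ∈ s, splitMean t a (f i) := by
  simp only [splitMean, Finset.mul_sum]
  exact Finset.sum_comm

/-! ### Cut-and-paste between one site and all the others -/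

/-- The columns in which site `a` has its bits from `S` and all other sites have theirs
from `S'`. -/
def combineCol {k : ℕ} (a : Fin k) (B B' : Finset (Fin k)) : Finset (Fin k) :=
  if a ∈ B then insert a B' else B'.erase a

theorem mem_combineCol {k : ℕ} {a : Fin k} {B B' : Finset (Fin k)} {i : Fin k} :
    i ∈ combineCol a B B' ↔ if i = a then a ∈ B else i ∈ B' := by
  unfold combineCol
  by_cases h : a ∈ B <;> by_cases hi : i = a <;> simp [h, hi]

/-- Only the bit of site `e.2` can depend on the coin. The coin therefore belongs to `a` when `e.2 =
a` and to the other sites otherwise, and combining inputs amounts to mixing coins. -/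
theorem combineCol_splitVal {k : ℕ} (a : Fin k) (e : Finset (Fin k) × Fin k) (x y : Bool) :
    combineCol a (splitVal e x) (splitVal e y) = splitVal e (if e.2 = a then x else y) := by
  ext i
  rw [mem_combineCol]
  by_cases hi : i = a
  · subst hi
    by_cases he : e.2 = i
    · simp [he]
    · have : ¬ i = e.2 := fun h => he h.symm
      cases x <;> cases y <;> simp [splitVal, he, this]
  · by_cases he : e.2 = a
    · have : ¬ i = e.2 := fun h => hi (h.trans he)
      cases x <;> cases y <;> simp [splitVal, he, hi]
    · simp [he, hi]

/-- The columns given by the pairs `d` and the coins `z`, with column `j` replaced by `B`. -/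
def splitCols {n k : ℕ} (d : Fin n → Finset (Fin k) × Fin k) (j : Fin n) (B : Finset (Fin k))
    (z : Fin n → Bool) : Fin n → Finset (Fin k) :=
  Function.update (fun i => splitVal (d i) (z i)) j B

theorem combineCol_splitCols {n k : ℕ} (d : Fin n → Finset (Fin k) × Fin k) (j : Fin n)
    (a : Fin k) (B B' : Finset (Fin k)) (z z' : Fin n → Bool) :
    (fun i => combineCol a (splitCols d j B z i) (splitCols d j B' z' i))
      = splitCols d j (combineCol a B B')
        ((Finset.univ.filter fun i => (d i).2 = a).piecewise z z') := by
  ext1 i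
  unfold splitCols
  by_cases hi : i = j
  · subst hi; simp
  · simp only [Function.update_of_ne hi, combineCol_splitVal]
    congr 1
    simp [Finset.piecewise]

section

variable {n k : ℕ} {β : Type*} (W : (Fin n → Finset (Fin k)) → β)

/-- The law of `W` when column `j` is `B` and the other columns are given by fair coins. -/
noncomputable def splitLaw (d : Fin n → Finset (Fin k) × Fin k) (j : Fin n)
    (B : Finset (Fin k)) (w : β) : ℝ :=
  coinProb fun z => W (splitCols d j B z) = w

/-- The Hellinger distance of the laws for column `j` being `A` or `insert b A`. -/
noncomputable def splitDist (R : Finset β) (d : Fin n → Finset (Fin k) × Fin k) (j : Fin n)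
    (e : Finset (Fin k) × Fin k) : ℝ :=
  hellingerSq R (splitLaw W d j e.1) (splitLaw W d j (insert e.2 e.1))

/-- Given the pairs `d`, the coins of `a` are independent of those of the others, and `hW` makes
each event `W = w` a rectangle. Adding `a` or `b` to `A` in column `j` gives the four inputs of AND.
`W` need not determine acceptance: by `hacc`, given `W = w`, acceptance depends only on the other
sites, whose part of column `j` is the same with and without `a`. -/
theorem sq_coinProb_sub_le (a : Fin k) (R : Finset β) (hR : ∀ S, W S ∈ R)
    (acc : (Fin n → Finset (Fin k)) → Prop)
    (hW : ∀ S S', W S = W S' → W (fun i => combineCol a (S i) (S' i)) = W S')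
    (hacc : ∀ S S', W S = W S' → (acc (fun i => combineCol a (S i) (S' i)) ↔ acc S'))
    (d : Fin n → Finset (Fin k) × Fin k) (j : Fin n) {A : Finset (Fin k)} {b : Fin k}
    (ha : a ∉ A) (hab : b ≠ a) :
    (coinProb (fun z => acc (splitCols d j (insert a (insert b A)) z))
        - coinProb (fun z => acc (splitCols d j (insert b A) z))) ^ 2
      ≤ 24 * (splitDist W R d j (A, b) + splitDist W R d j (A, a)) := by
  set J := Finset.univ.filter fun i => (d i).2 = a with hJ
  have hab' : a ≠ b := hab.symm
  have e1 : ∀ B, a ∉ B → combineCol a A B = B := by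
    intro B hB; simp [combineCol, ha, hB]
  have e2 : ∀ B B', a ∈ B → combineCol a B B' = insert a B' := by
    intro B B' hB; simp [combineCol, hB]
  have e3 : ∀ B B', a ∉ B → a ∉ B' → combineCol a B (insert a B') = B' := by
    intro B B' hB hB'; simp [combineCol, hB, hB']
  have e4 : ∀ B B', a ∉ B → a ∉ B' → combineCol a B B' = B' := by
    intro B B' hB hB'; simp [combineCol, hB, hB']
  have hbA : a ∉ insert b A := by simp [hab', ha]
  have inv : ∀ u v : Fin n → Bool,
      J.piecewise (J.piecewise u v) (J.piecewise v u) = u := by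
    intro u v; ext i; by_cases hi : i ∈ J <;> simp [hi]
  have comb : ∀ (B B' : Finset (Fin k)) z z' w, W (splitCols d j B z) = w →
      W (splitCols d j B' z') = w →
      W (splitCols d j (combineCol a B B') (J.piecewise z z')) = w ∧
      (acc (splitCols d j (combineCol a B B') (J.piecewise z z'))
        ↔ acc (splitCols d j B' z')) := by
    intro B B' z z' w h h'
    rw [hJ, ← combineCol_splitCols]
    exact ⟨(hW _ _ (h.trans h'.symm)).trans h', hacc _ _ (h.trans h'.symm)⟩
  -- Two copies exchange the part of `a`, coins and bit of column `j` alike, which turns the columns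
  -- `00`, `11` into `01`, `10`.
  have hcut : ∀ w, splitLaw W d j A w * splitLaw W d j (insert a (insert b A)) w
      = splitLaw W d j (insert b A) w * splitLaw W d j (insert a A) w := by
    intro w
    refine coinProb_mul_eq_of_mix J fun z z' => ⟨fun ⟨h, h'⟩ => ⟨?_, ?_⟩, fun ⟨h, h'⟩ => ⟨?_, ?_⟩⟩
    · have := (comb _ _ _ _ _ h h').1
      rwa [e3 _ _ ha hbA] at this
    · have := (comb _ _ _ _ _ h' h).1
      rwa [e2 _ _ (Finset.mem_insert_self _ _)] at this
    · have := (comb _ _ _ _ _ h h').1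
      rwa [e3 _ _ hbA ha, inv] at this
    · have := (comb _ _ _ _ _ h' h).1
      rwa [e2 _ _ (Finset.mem_insert_self _ _), inv] at this
  have hcut' : ∀ w, coinProb (fun z => W (splitCols d j (insert a (insert b A)) z) = w ∧
        acc (splitCols d j (insert a (insert b A)) z)) * splitLaw W d j (insert b A) w
      = coinProb (fun z => W (splitCols d j (insert b A) z) = w ∧
        acc (splitCols d j (insert b A) z)) * splitLaw W d j (insert a (insert b A)) w := by
    intro w
    rw [mul_comm (coinProb (fun z => W (splitCols d j (insert b A) z) = w ∧ _))]
    refine coinProb_mul_eq_of_mix J fun z z' => ⟨fun ⟨⟨h, h0⟩, h'⟩ => ?_, fun ⟨h, ⟨h', h0⟩⟩ => ?_⟩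
    · have h1 := comb _ _ _ _ _ h h'
      have h2 := comb _ _ _ _ _ h' h
      rw [e2 _ _ (Finset.mem_insert_self _ _)] at h1
      rw [e3 _ _ hbA hbA] at h2
      exact ⟨h1.1, h2.1, h2.2.2 h0⟩
    · have h1 := comb _ _ _ _ _ h h'
      have h2 := comb _ _ _ _ _ h' h
      rw [e2 _ _ (Finset.mem_insert_self _ _), inv] at h1
      rw [e3 _ _ hbA hbA, inv] at h2
      exact ⟨⟨h1.1, h1.2.2 h0⟩, h2.1⟩
  have one : ∀ B, ∑ w ∈ R, splitLaw W d j B w = 1 := fun B =>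
    sum_coinProb_eq_one _ R fun z => hR _
  have main := sq_sum_sub_le_of_cut_paste R
    (p00 := splitLaw W d j A) (p01 := splitLaw W d j (insert b A))
    (p10 := splitLaw W d j (insert a A)) (p11 := splitLaw W d j (insert a (insert b A)))
    (r := fun w => coinProb fun z => W (splitCols d j (insert a (insert b A)) z) = w ∧
      acc (splitCols d j (insert a (insert b A)) z))
    (r' := fun w => coinProb fun z => W (splitCols d j (insert b A) z) = w ∧
      acc (splitCols d j (insert b A) z))
    (fun w _ => coinProb_nonneg _) (fun w _ => coinProb_nonneg _) (fun w _ => coinProb_nonneg _)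
    (fun w _ => coinProb_nonneg _) (one _).le (one _).le ((one _).trans (one _).symm)
    ((one _).trans (one _).symm) (fun w _ => hcut w) (fun w _ => coinProb_nonneg _)
    (fun w _ => coinProb_nonneg _) (fun w _ => coinProb_mono fun z h => h.1)
    (fun w _ => coinProb_mono fun z h => h.1) (fun w _ => hcut' w)
  rwa [sum_coinProb_and_eq _ R (fun z => hR _), sum_coinProb_and_eq _ R (fun z => hR _)] at main

/-- The pairs `(A, b)` for which adding `b`, and then `a`, to `A` raises the frequency from `t` to
`t + 1` and then `t + 2`. -/
def goodPairs (t : ℕ) (a : Fin k) : Finset (Finset (Fin k) × Fin k) :=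
  Finset.univ.filter fun e => e.1.card = t ∧ a ∉ e.1 ∧ e.2 ∉ e.1 ∧ e.2 ≠ a

theorem splitDist_nonneg (R : Finset β) (d : Fin n → Finset (Fin k) × Fin k) (j : Fin n)
    (e : Finset (Fin k) × Fin k) : 0 ≤ splitDist W R d j e :=
  hellingerSq_nonneg _ _ _

/-- For fixed `A` the distance at `(A, a)` occurs on the left once for each `b`, so at most `k`
times, while its weight on the right is `t + 1`. The factor `(t + 1) / k` balances this, and being
at most `1` it does no harm to the pairs `(A, b)` of weight `1`. -/
theorem sum_goodPairs_splitDist_le {t : ℕ} (htk : t + 1 ≤ k) (a : Fin k) (R : Finset β)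
    (d : Fin n → Finset (Fin k) × Fin k) (j : Fin n) :
    ((t : ℝ) + 1) / k * ∑ e ∈ goodPairs t a, (splitDist W R d j e + splitDist W R d j (e.1, a))
      ≤ ∑ e, splitWt t a e * splitDist W R d j e := by
  have hk : (0 : ℝ) < k := by exact_mod_cast (by omega : 0 < k)
  have htk' : ((t : ℝ) + 1) ≤ k := by exact_mod_cast htk
  have hratio : ((t : ℝ) + 1) / k ≤ 1 := (div_le_one hk).2 htk'
  rw [goodPairs, Finset.sum_filter, Fintype.sum_prod_type, Fintype.sum_prod_type, Finset.mul_sum]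
  refine Finset.sum_le_sum fun A _ => ?_
  set H : Fin k → ℝ := fun b => splitDist W R d j (A, b) with hH
  have hH0 : ∀ b, 0 ≤ H b := fun b => splitDist_nonneg W R d j _
  by_cases hA : A.card = t ∧ a ∉ A
  · obtain ⟨hc, ha⟩ := hA
    set g : Fin k → ℝ := fun b => if b ∉ A ∧ b ≠ a then 1 else 0 with hg
    have hg0 : ∀ b, 0 ≤ g b := by intro b; simp only [hg]; split_ifs <;> norm_num
    have hgk : ∑ b, g b ≤ k := by
      calc ∑ b, g b ≤ ∑ _b : Fin k, (1 : ℝ) := by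
            refine Finset.sum_le_sum fun b _ => ?_
            simp only [hg]; split_ifs <;> norm_num
        _ = k := by simp
    have h1 : ∀ b, splitWt t a (A, b) * splitDist W R d j (A, b)
        = (if b = a then ((t : ℝ) + 1) * H a else 0) + g b * H b := by
      intro b
      by_cases hb : b = a
      · subst hb; simp [splitWt, hc, ha, hg, hH]
      · simp [splitWt, hc, ha, hg, hH, hb]
    have h2 : ∀ b, (if (A, b).1.card = t ∧ a ∉ (A, b).1 ∧ (A, b).2 ∉ (A, b).1 ∧ (A, b).2 ≠ a then
        splitDist W R d j (A, b) + splitDist W R d j ((A, b).1, a) else 0)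
        = g b * H b + g b * H a := by
      intro b
      by_cases hb : b ∉ A ∧ b ≠ a
      · simp [hc, ha, hb, hg, hH]
      · rw [if_neg (by tauto)]; simp only [hg, if_neg hb]; ring
    rw [Finset.sum_congr rfl fun b _ => h1 b, Finset.sum_congr rfl fun b _ => h2 b,
      Finset.sum_add_distrib, Finset.sum_add_distrib, ← Finset.sum_mul]
    simp only [Finset.sum_ite_eq', Finset.mem_univ, if_true]
    have h3 : 0 ≤ ∑ b, g b * H b := Finset.sum_nonneg fun b _ => mul_nonneg (hg0 b) (hH0 b)
    have h4 : ((t : ℝ) + 1) / k * ((∑ b, g b) * H a) ≤ ((t : ℝ) + 1) * H a := by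
      rw [div_mul_eq_mul_div, div_le_iff₀ hk, mul_assoc]
      refine mul_le_mul_of_nonneg_left ?_ (by positivity)
      rw [mul_comm (H a)]
      exact mul_le_mul_of_nonneg_right hgk (hH0 a)
    have h5 := mul_le_mul_of_nonneg_right hratio h3
    rw [mul_add]
    linarith
  · rw [Finset.sum_eq_zero, mul_zero]
    · exact Finset.sum_nonneg fun b _ => mul_nonneg (splitWt_nonneg _ _ _) (hH0 b)
    · intro b _
      exact if_neg (by tauto)

open scoped Classical in
/-- The lower bound on the information that the view of a single site reveals. -/
theorem code_length_lower_bound {t : ℕ} (htk : t + 1 ≤ k) (hM : 0 < totalWt k t) (a : Fin k)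
    (R : Finset β) (hR : ∀ S, W S ∈ R)
    (acc : Fin n → (Fin n → Finset (Fin k)) → Prop)
    (hW : ∀ S S', W S = W S' → W (fun i => combineCol a (S i) (S' i)) = W S')
    (hacc : ∀ j S S', W S = W S' → (acc j (fun i => combineCol a (S i) (S' i)) ↔ acc j S'))
    (Q : β → ℝ) (hQ : ∀ w ∈ R, 0 < Q w) (hQ1 : ∑ w ∈ R, Q w ≤ 1) :
    ((t : ℝ) + 1) / (48 * k * totalWt k t) * ∑ j : Fin n, ∑ e ∈ goodPairs t a,
        (2 / 3 * (colMean t (fun S =>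
            if acc j (Function.update S j (insert a (insert e.2 e.1))) then (1 : ℝ) else 0)
          - colMean t (fun S =>
            if acc j (Function.update S j (insert e.2 e.1)) then (1 : ℝ) else 0)) - 1 / 9)
      ≤ colMean t fun S => -Real.log (Q (W S)) := by
  have hk : (0 : ℝ) < k := by exact_mod_cast (by omega : 0 < k)
  have hupd : ∀ (d : Fin n → Finset (Fin k) × Fin k) (j : Fin n) (c : Bool) (z : Fin n → Bool),
      (fun i => splitVal (d i) (Function.update z j c i)) = splitCols d j (splitVal (d j) c) z := by
    intro d j c z
    ext1 i
    unfold splitCols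
    by_cases hi : i = j
    · subst hi; simp
    · simp [hi]
  have h1 : ∀ d : Fin n → Finset (Fin k) × Fin k, 1 / 4 * ∑ j, splitDist W R d j (d j)
      ≤ (∑ z : Fin n → Bool, -Real.log (Q (W fun i => splitVal (d i) (z i)))) / 2 ^ n := by
    intro d
    have := sum_hellingerSq_le_code (fun z : Fin n → Bool => W fun i => splitVal (d i) (z i)) R
      (fun z => hR _) Q hQ hQ1
    simp only [hupd] at this
    exact this
  have hprob : ∀ (a' : Fin n) (B : Finset (Fin k)),
      colMean t (fun S => if acc a' (Function.update S a' B) then (1 : ℝ) else 0)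
        = splitMean t a fun d => coinProb fun z => acc a' (splitCols d a' B z) := by
    intro j B
    rw [colMean_eq_splitMean t a]
    congr 1
    funext d
    rw [coinProb_eq_sum]
    rfl
  rw [colMean_eq_splitMean t a]
  refine le_trans ?_ (splitMean_mono t a hM h1)
  rw [splitMean_const_mul, splitMean_sum, Finset.mul_sum, Finset.mul_sum]
  refine Finset.sum_le_sum fun j _ => ?_
  rw [splitMean_resample t a hM j]
  -- `splitCols` overwrites column `j`, so the pair at `j` can be redrawn without changing the laws
  -- that are compared.
  have hlaw : ∀ (d : Fin n → Finset (Fin k) × Fin k) e,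
      splitDist W R (Function.update d j e) j (Function.update d j e j) = splitDist W R d j e := by
    intro d e
    have : ∀ B, splitLaw W (Function.update d j e) j B = splitLaw W d j B := by
      intro B
      have hc : ∀ z, splitCols (Function.update d j e) j B z = splitCols d j B z := by
        intro z
        ext1 i
        unfold splitCols
        by_cases hi : i = j
        · subst hi; simp
        · simp [hi]
      funext w
      simp only [splitLaw, hc]
    simp only [splitDist, this, Function.update_self]
  simp only [hlaw]
  have h2 : ∀ d : Fin n → Finset (Fin k) × Fin k,
      2 / totalWt k t * (((t : ℝ) + 1) / k * ∑ e ∈ goodPairs t a, 1 / 24 *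
        (2 / 3 * (coinProb (fun z => acc j (splitCols d j (insert a (insert e.2 e.1)) z))
        - coinProb (fun z => acc j (splitCols d j (insert e.2 e.1) z))) - 1 / 9))
      ≤ ∑ e, 2 * splitWt t a e / totalWt k t * splitDist W R d j e := by
    intro d
    have h3 : ∑ e, 2 * splitWt t a e / totalWt k t * splitDist W R d j e
        = 2 / totalWt k t * ∑ e, splitWt t a e * splitDist W R d j e := by
      rw [Finset.mul_sum]
      exact Finset.sum_congr rfl fun e _ => by ring
    rw [h3]
    refine mul_le_mul_of_nonneg_left ?_ (by positivity)
    refine le_trans ?_ (sum_goodPairs_splitDist_le W htk a R d j)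
    refine mul_le_mul_of_nonneg_left (Finset.sum_le_sum fun e he => ?_) (by positivity)
    simp only [goodPairs, Finset.mem_filter, Finset.mem_univ, true_and] at he
    have h4 := sq_coinProb_sub_le W a R hR (acc j) hW (hacc j) d j (A := e.1) (b := e.2)
      he.2.1 he.2.2.2
    set x := coinProb (fun z => acc j (splitCols d j (insert a (insert e.2 e.1)) z))
        - coinProb (fun z => acc j (splitCols d j (insert e.2 e.1) z))
    have h5 : splitDist W R d j (e.1, e.2) = splitDist W R d j e := rfl
    rw [h5] at h4
    -- The tangent bound `x² ≥ 2x/3 - 1/9` at `x = 1/3` is linear in `x`, so later only the average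
    -- of the gaps matters.
    nlinarith [sq_nonneg (x - 1 / 3)]
  have h6 := mul_le_mul_of_nonneg_left (splitMean_mono t a hM h2) (by norm_num : (0:ℝ) ≤ 1 / 4)
  refine le_trans (le_of_eq ?_) h6
  rw [splitMean_const_mul, splitMean_const_mul, splitMean_sum, Finset.mul_sum, Finset.mul_sum,
    Finset.mul_sum, Finset.mul_sum]
  refine Finset.sum_congr rfl fun e _ => ?_
  rw [splitMean_const_mul, hprob, hprob]
  have h7 : ∀ f g : (Fin n → Finset (Fin k) × Fin k) → ℝ,
      splitMean t a (fun d => 2 / 3 * (f d - g d) - 1 / 9)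
        = 2 / 3 * (splitMean t a f - splitMean t a g) - 1 / 9 := by
    intro f g
    have h8 : (fun d => 2 / 3 * (f d - g d) - 1 / 9)
        = fun d => (2 / 3 * f d + (-(2 / 3)) * g d) + (-(1 / 9) : ℝ) := by
      funext d; ring
    rw [h8, splitMean_add, splitMean_add, splitMean_const_mul, splitMean_const_mul,
      splitMean_const t a hM]
    ring
  rw [h7]
  field_simp
  ring

end

/-! ### Counting good pairs; means over columns; columns versus inputs -/

theorem totalWt_eq (k t : ℕ) : totalWt k t = k * k.choose t + (t + 1) * k.choose (t + 1) := by
  have h : ∀ B : Finset (Fin k), colWt t B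
      = (if B.card = t then (k : ℝ) else 0) + if B.card = t + 1 then (t : ℝ) + 1 else 0 := by
    intro B
    unfold colWt
    by_cases h1 : B.card = t
    · simp [h1]
    · simp [h1]
  have h2 : ∀ s, (Finset.univ.filter fun B : Finset (Fin k) => B.card = s).card = k.choose s := by
    intro s
    have := Finset.card_powersetCard s (Finset.univ : Finset (Fin k))
    rw [Finset.card_univ, Fintype.card_fin] at this
    rw [← this]
    congr 1
    ext B; simp [Finset.mem_powersetCard]
  unfold totalWt
  rw [Finset.sum_congr rfl fun B _ => h B, Finset.sum_add_distrib, ← Finset.sum_filter,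
    ← Finset.sum_filter, Finset.sum_const, Finset.sum_const, h2, h2, nsmul_eq_mul, nsmul_eq_mul]
  ring

theorem totalWt_pos {k t : ℕ} (htk : t + 1 ≤ k) : 0 < totalWt k t := by
  rw [totalWt_eq]
  have h1 : 0 < k.choose t := Nat.choose_pos (by omega)
  have h2 : 0 < k := by omega
  positivity

theorem card_goodPairs {k : ℕ} (t : ℕ) (a : Fin k) :
    (goodPairs t a).card = (k - 1).choose t * (k - 1 - t) := by
  have h1 : (goodPairs t a).card = ∑ A : Finset (Fin k), if A.card = t ∧ a ∉ A then
      (k - 1 - t) else 0 := by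
    rw [goodPairs, Finset.card_filter, Fintype.sum_prod_type]
    refine Finset.sum_congr rfl fun A _ => ?_
    by_cases hA : A.card = t ∧ a ∉ A
    · rw [if_pos hA, ← Finset.card_filter]
      have : Finset.univ.filter (fun b => A.card = t ∧ a ∉ A ∧ b ∉ A ∧ b ≠ a)
          = Finset.univ \ insert a A := by
        ext b; simp [hA, and_comm]
      rw [this, Finset.card_sdiff_of_subset (Finset.subset_univ _),
        Finset.card_insert_of_notMem hA.2, hA.1, Finset.card_univ, Fintype.card_fin]
      omega
    · rw [if_neg hA]
      exact Finset.sum_eq_zero fun b _ => if_neg (by tauto)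
  rw [h1, ← Finset.sum_filter, Finset.sum_const, smul_eq_mul]
  congr 1
  have h2 := Finset.card_powersetCard t ((Finset.univ : Finset (Fin k)).erase a)
  rw [Finset.card_erase_of_mem (Finset.mem_univ _), Finset.card_univ, Fintype.card_fin] at h2
  rw [← h2]
  congr 1
  ext B
  simp only [Finset.mem_filter, Finset.mem_univ, true_and, Finset.mem_powersetCard,
    Finset.subset_erase, Finset.subset_univ]
  tauto

/-- Both `(t + 1) C(k, t + 1)` and `k C(k - 1, t)` equal `(k - t) C(k, t)`, so the ratio is `k (2k -
t) / ((k - t)(k - 1 - t))`, which is bounded for `t ≤ (k - 1) / 2`. Good pairs hence carry a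
constant fraction of the mixture. -/
theorem totalWt_le_card_goodPairs {k t : ℕ} (hk : 2 ≤ k) (htk : 2 * t + 1 ≤ k) (a : Fin k) :
    totalWt k t ≤ 12 * (goodPairs t a).card := by
  rw [totalWt_eq, card_goodPairs]
  obtain ⟨m, rfl⟩ : ∃ m, k = m + 1 := ⟨k - 1, by omega⟩
  have h1 := Nat.choose_succ_right_eq (m + 1) t
  have h2 := Nat.choose_mul_succ_eq m t
  have h3 : (((m + 1).choose (t + 1) * (t + 1) : ℕ) : ℝ) = (((m + 1).choose t * (m + 1 - t) : ℕ) : ℝ) :=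
    by rw [h1]
  have h4 : ((m.choose t * (m + 1) : ℕ) : ℝ) = (((m + 1).choose t * (m + 1 - t) : ℕ) : ℝ) := by
    rw [h2]
  have e1 : ((m + 1 - t : ℕ) : ℝ) = m + 1 - t := by rw [Nat.cast_sub (by omega)]; push_cast; ring
  have e2 : ((m - t : ℕ) : ℝ) = m - t := Nat.cast_sub (by omega)
  rw [Nat.add_sub_cancel]
  have hm : (1 : ℝ) ≤ m := by exact_mod_cast (by omega : 1 ≤ m)
  have ht : 2 * (t : ℝ) ≤ m := by exact_mod_cast (by omega : 2 * t ≤ m)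
  push_cast [e1, e2] at h3 h4 ⊢
  set c : ℝ := ((m + 1).choose t : ℝ)
  have hc : 0 ≤ c := by positivity
  have ht0 : (0 : ℝ) ≤ t := by positivity
  have hm1 : (0 : ℝ) < m + 1 := by linarith
  rw [show (t + 1 : ℝ) * ((m + 1).choose (t + 1) : ℝ) = c * (m + 1 - t) by linarith]
  rw [← mul_le_mul_iff_left₀ hm1]
  have h5 : 12 * ((m.choose t : ℝ) * (m - t)) * (m + 1) = 12 * (c * (m + 1 - t)) * (m - t) := by
    rw [← h4]; ring
  rw [h5]
  have h6 : ((m + 1 : ℝ) + (m + 1 - t)) * (m + 1) ≤ 12 * (m + 1 - t) * (m - t) := by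
    nlinarith [mul_nonneg ht0 (by linarith : (0 : ℝ) ≤ m - 2 * t),
      mul_nonneg (by linarith : (0 : ℝ) ≤ m - 2 * t) (by linarith : (0 : ℝ) ≤ m - 2 * t)]
  nlinarith [mul_le_mul_of_nonneg_left h6 hc]

theorem colMean_mono {n k : ℕ} (t : ℕ) {F G : (Fin n → Finset (Fin k)) → ℝ}
    (h : ∀ S, (∀ i, colWt t (S i) ≠ 0) → F S ≤ G S) : colMean t F ≤ colMean t G := by
  unfold colMean
  have hM : 0 ≤ totalWt k t := Finset.sum_nonneg fun B _ => colWt_nonneg t B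
  refine div_le_div_of_nonneg_right (Finset.sum_le_sum fun S _ => ?_) (by positivity)
  by_cases hS : ∀ i, colWt t (S i) ≠ 0
  · exact mul_le_mul_of_nonneg_left (h S hS) (Finset.prod_nonneg fun i _ => colWt_nonneg t _)
  · push Not at hS
    obtain ⟨i, hi⟩ := hS
    rw [Finset.prod_eq_zero (Finset.mem_univ i) hi]; simp

theorem colMean_const {n k : ℕ} {t : ℕ} (hM : 0 < totalWt k t) (c : ℝ) :
    colMean (n := n) (k := k) t (fun _ => c) = c := by
  unfold colMean
  have h := Finset.prod_univ_sum (fun _ : Fin n => (Finset.univ : Finset (Finset (Fin k))))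
    (fun _ B => colWt t B)
  rw [Fintype.piFinset_univ] at h
  rw [← Finset.sum_mul, ← h]
  simp only [Finset.prod_const, Finset.card_univ, Fintype.card_fin]
  change totalWt k t ^ n * c / totalWt k t ^ n = c
  field_simp

theorem colMean_sum {n k : ℕ} {ι : Type*} (s : Finset ι) (t : ℕ)
    (F : ι → (Fin n → Finset (Fin k)) → ℝ) :
    colMean t (fun S => ∑ i ∈ s, F i S) = ∑ i ∈ s, colMean t (F i) := by
  unfold colMean
  rw [← Finset.sum_div, Finset.sum_comm]
  simp only [Finset.mul_sum]

/-- The sets held by the sites, given the columns. -/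
def rowsOf {n k : ℕ} (S : Fin n → Finset (Fin k)) (i : Fin k) : Finset (Fin n) :=
  Finset.univ.filter fun x => i ∈ S x

theorem rowsOf_combineCol {n k : ℕ} (S S' : Fin n → Finset (Fin k)) (a : Fin k) :
    rowsOf (fun i => combineCol a (S i) (S' i))
      = Function.update (rowsOf S') a (rowsOf S a) := by
  ext1 i
  by_cases hi : i = a
  · subst hi; ext x; simp [rowsOf, mem_combineCol]
  · ext x; simp [rowsOf, mem_combineCol, hi]

theorem freq_rowsOf {n k : ℕ} (S : Fin n → Finset (Fin k)) (x : Fin n) :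
    freq (rowsOf S) x = (S x).card := by
  simp [freq, rowsOf]

/-! ### Encoding the views of all sites -/

/-- A code for the runs seen by a single site. -/
noncomputable def siteCode {k : ℕ} {T : Type} [Fintype T] (q : List (Message k) × Option T) : ℝ :=
  (1 - 1 / k) * ((1 / k : ℝ) / Fintype.card (Message k)) ^ q.1.length *
    (match q.2 with
      | none => 1 - 1 / k
      | some _ => 1 / k / Fintype.card T)

theorem siteCode_pos {k : ℕ} {T : Type} [Fintype T] (hk : 2 ≤ k) (hT : 0 < Fintype.card T)
    (q : List (Message k) × Option T) : 0 < siteCode q := by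
  have hk' : (2 : ℝ) ≤ k := by exact_mod_cast hk
  have h1 : (0 : ℝ) < 1 - 1 / k := by
    rw [sub_pos, div_lt_one (by linarith)]; linarith
  have h2 : 0 < Fintype.card (Message k) := by rw [card_message]; positivity
  unfold siteCode
  rcases q with ⟨v, _ | o⟩ <;> simp only <;> positivity

theorem sum_siteCode_le_one {k : ℕ} {T : Type} [Fintype T] (hk : 2 ≤ k)
    (hT : 0 < Fintype.card T) (R : Finset (List (Message k) × Option T)) :
    ∑ q ∈ R, siteCode q ≤ 1 := by
  classical
  have hk' : (2 : ℝ) ≤ k := by exact_mod_cast hk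
  have hsub : R ⊆ R.image Prod.fst ×ˢ Finset.univ := by
    intro q hq
    exact Finset.mem_product.2 ⟨Finset.mem_image_of_mem _ hq, Finset.mem_univ _⟩
  refine (Finset.sum_le_sum_of_subset_of_nonneg hsub
    fun q _ _ => (siteCode_pos hk hT q).le).trans ?_
  rw [Finset.sum_product]
  have hT' : (Fintype.card T : ℝ) ≠ 0 := by positivity
  have hk0 : (k : ℝ) ≠ 0 := by positivity
  have h : ∀ v : List (Message k), ∑ o : Option T, siteCode (v, o)
      = (1 - 1 / k) * ((1 / k : ℝ) / Fintype.card (Message k)) ^ v.length := by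
    intro v
    simp only [siteCode]
    rw [← Finset.mul_sum, Fintype.sum_option]
    simp only [Finset.sum_const, Finset.card_univ, nsmul_eq_mul]
    rw [mul_div_cancel₀ _ hT']
    ring
  rw [Finset.sum_congr rfl fun v _ => h v]
  refine sum_pow_length_le _ (by positivity) ?_ (by rw [card_message]; positivity)
  rw [div_lt_one (by linarith)]; linarith

/-- The parameter `1 / k` of the geometric code makes each recorded bit cost `log (2k³) ≤ 4 log k`,
but ending a view costs only `O(1 / k)`. The flag for "no report" costs as little, and at most one
site pays for reporting. So the overhead not tied to bits or to the report stays bounded when summed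
over the `k` sites. -/
theorem neg_log_siteCode_le {k : ℕ} {T : Type} [Fintype T] (hk : 2 ≤ k)
    (hT : 0 < Fintype.card T) (q : List (Message k) × Option T) :
    -Real.log (siteCode q) ≤ q.1.length * (4 * Real.log k) + 4 / k
      + if q.2.isSome then Real.log (Fintype.card T) + Real.log k else 0 := by
  have hk' : (2 : ℝ) ≤ k := by exact_mod_cast hk
  have hk0 : (0 : ℝ) < k := by linarith
  have h1 : (0 : ℝ) < 1 - 1 / k := by
    rw [sub_pos, div_lt_one (by linarith)]; linarith
  have hm : (Fintype.card (Message k) : ℝ) = 2 * k ^ 2 := by rw [card_message]; push_cast; ring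
  have hl1 : -Real.log (1 - 1 / k) ≤ 2 / k := by
    have := Real.log_le_sub_one_of_pos (inv_pos.2 h1)
    rw [Real.log_inv] at this
    refine this.trans ?_
    rw [show (1 : ℝ) - 1 / k = (k - 1) / k by field_simp, inv_div, div_sub_one (by linarith),
      sub_sub_cancel, div_le_div_iff₀ (by linarith) hk0]
    linarith
  have hT' : (0 : ℝ) < Fintype.card T := by exact_mod_cast hT
  have hlk : 0 ≤ Real.log k := Real.log_nonneg (by linarith)
  have hl2 : -Real.log ((1 / k : ℝ) / Fintype.card (Message k)) ≤ 4 * Real.log k := by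
    rw [hm, ← Real.log_inv]
    have : ((1 / k : ℝ) / (2 * k ^ 2))⁻¹ = 2 * (k : ℝ) ^ 3 := by field_simp
    rw [this, Real.log_mul (by norm_num) (by positivity), Real.log_pow]
    have := Real.log_le_log (by norm_num) hk'
    push_cast; linarith
  have hpos : (0 : ℝ) < (1 / k : ℝ) / Fintype.card (Message k) := by rw [hm]; positivity
  have h0 : (0 : ℝ) ≤ 2 / k := by positivity
  have h3 := mul_le_mul_of_nonneg_left hl2 (Nat.cast_nonneg (α := ℝ) q.1.length)
  have h4 : (4 : ℝ) / k = 2 / k + 2 / k := by ring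
  rcases q with ⟨v, _ | o⟩
  · simp only [siteCode, Option.isSome_none, Bool.false_eq_true, if_false]
    rw [Real.log_mul (mul_pos h1 (pow_pos hpos _)).ne' h1.ne', Real.log_mul h1.ne'
      (pow_pos hpos _).ne', Real.log_pow]
    simp only at h3
    linarith
  · simp only [siteCode, Option.isSome_some, if_true]
    have h5 : (0 : ℝ) < 1 / k / Fintype.card T := by positivity
    rw [Real.log_mul (mul_pos h1 (pow_pos hpos _)).ne' h5.ne', Real.log_mul h1.ne'
      (pow_pos hpos _).ne', Real.log_pow]
    have h6 : Real.log (1 / k / Fintype.card T) = -Real.log k - Real.log (Fintype.card T) := by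
      rw [Real.log_div (by positivity) hT'.ne', one_div, Real.log_inv]
    rw [h6]
    simp only at h3
    linarith

theorem sum_neg_log_siteCode_le {k : ℕ} {X Y T : Type} [Fintype T] (hk : 2 ≤ k)
    (hT : 0 < Fintype.card T) (P : Protocol k X Y) (C : ℕ) (τ : Y → T) (x : Fin k → X) :
    ∑ a, -Real.log (siteCode (P.localRun C τ a x))
      ≤ 8 * C * Real.log k + 4 + Real.log (Fintype.card T) + Real.log k := by
  have hk' : (2 : ℝ) ≤ k := by exact_mod_cast hk
  have hlk : 0 ≤ Real.log k := Real.log_nonneg (by linarith)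
  have hlT : 0 ≤ Real.log (Fintype.card T) := Real.log_nonneg (by exact_mod_cast hT)
  refine (Finset.sum_le_sum fun a _ => neg_log_siteCode_le hk hT _).trans ?_
  rw [Finset.sum_add_distrib, Finset.sum_add_distrib, ← Finset.sum_mul, ← Nat.cast_sum]
  have h1 : ((∑ a, (P.localRun C τ a x).1.length : ℕ) : ℝ) ≤ 2 * C := by
    have h := (sum_length_view_le (P.transcript x C)).trans
      (Nat.mul_le_mul_left 2 (P.length_transcript_le x C))
    exact_mod_cast h
  have h2 : ∑ a : Fin k, (4 : ℝ) / k = 4 := by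
    simp only [Finset.sum_const, Finset.card_univ, Fintype.card_fin, nsmul_eq_mul]
    rw [mul_div_cancel₀]; positivity
  have h3 : ∑ a, (if (P.localRun C τ a x).2.isSome then
      Real.log (Fintype.card T) + Real.log k else 0) ≤ Real.log (Fintype.card T) + Real.log k := by
    cases hn : P.next (P.transcript x C) with
    | send i j =>
      rw [Finset.sum_eq_zero]
      · linarith
      · intro a _; simp [Protocol.localRun, Protocol.outcomeAt, hn]
    | report i =>
      rw [Finset.sum_eq_single i]
      · split_ifs <;> linarith
      · intro a _ ha
        simp [Protocol.localRun, Protocol.outcomeAt, hn, ha.symm]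
      · simp
  rw [h2]
  have h4 := mul_le_mul_of_nonneg_right h1 (by linarith : 0 ≤ 4 * Real.log k)
  linarith

/-! ### From an average gap to communication -/

open scoped Classical in
/-- The probability of the answer `y` when column `j` is `B` and the other columns are random. -/
noncomputable def Protocol.acceptProb {n k : ℕ} {Y T : Type} (P : Protocol k (Finset (Fin n)) Y)
    (C : ℕ) (τ : Y → T) (t : ℕ) (j : Fin n) (B : Finset (Fin k)) (y : T) : ℝ :=
  colMean t fun S =>
    if P.outcome C τ (rowsOf (Function.update S j B)) = some y then (1 : ℝ) else 0

/-- A deterministic protocol whose answer tells apart, on average over the hard distribution, a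
planted element of frequency `t + 2` has to communicate a lot. -/
theorem communication_lower_bound {n k t : ℕ} {Y T : Type} [Fintype T] (hk : 2 ≤ k)
    (htk : 2 * t + 1 ≤ k) (hT : 0 < Fintype.card T) (P : Protocol k (Finset (Fin n)) Y) (C : ℕ)
    (τ : Y → T) (target : Fin n → T)
    (hgap : 1 / 3 * ∑ a : Fin k, ∑ _j : Fin n, ∑ _e ∈ goodPairs t a, (1 : ℝ)
      ≤ ∑ a : Fin k, ∑ j : Fin n, ∑ e ∈ goodPairs t a,
        (P.acceptProb C τ t j (insert a (insert e.2 e.1)) (target j)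
          - P.acceptProb C τ t j (insert e.2 e.1) (target j))) :
    ((t : ℝ) + 1) * n / 5184
      ≤ 8 * C * Real.log k + 4 + Real.log (Fintype.card T) + Real.log k := by
  classical
  have htk' : t + 1 ≤ k := by omega
  have hM := totalWt_pos htk'
  have hk0 : (0 : ℝ) < k := by positivity
  have lower := fun a : Fin k => code_length_lower_bound
    (fun S : Fin n → Finset (Fin k) => P.localRun C τ a (rowsOf S)) htk' hM a
    (Finset.univ.image fun S : Fin n → Finset (Fin k) => P.localRun C τ a (rowsOf S))
    (fun S => Finset.mem_image_of_mem _ (Finset.mem_univ S))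
    (fun j S => P.outcome C τ (rowsOf S) = some (target j))
    (fun S S' h => by
      rw [rowsOf_combineCol]; exact (P.outcome_update_eq C τ _ _ a h).2)
    (fun j S S' h => by
      rw [rowsOf_combineCol, (P.outcome_update_eq C τ _ _ a h).1])
    siteCode (fun w _ => siteCode_pos hk hT w) (sum_siteCode_le_one hk hT _)
  have upper : ∑ a : Fin k, colMean t (fun S : Fin n → Finset (Fin k) =>
      -Real.log (siteCode (P.localRun C τ a (rowsOf S))))
      ≤ 8 * C * Real.log k + 4 + Real.log (Fintype.card T) + Real.log k := by
    rw [← colMean_sum]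
    refine (colMean_mono t fun S _ => sum_neg_log_siteCode_le hk hT P C τ (rowsOf S)).trans ?_
    rw [colMean_const hM]
  refine le_trans ?_ ((Finset.sum_le_sum fun a _ => lower a).trans upper)
  rw [← Finset.mul_sum]
  have hsplit : ∀ g : Fin k → Fin n → Finset (Fin k) × Fin k → ℝ,
      ∑ a : Fin k, ∑ j : Fin n, ∑ e ∈ goodPairs t a, (2 / 3 * g a j e - 1 / 9)
        = 2 / 3 * ∑ a : Fin k, ∑ j : Fin n, ∑ e ∈ goodPairs t a, g a j e
          - ∑ a : Fin k, ∑ _j : Fin n, ∑ _e ∈ goodPairs t a, (1 / 9 : ℝ) := by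
    intro g
    simp only [Finset.sum_sub_distrib, Finset.mul_sum]
  rw [hsplit]
  have hcount : k * n * totalWt k t / 12
      ≤ ∑ a : Fin k, ∑ _j : Fin n, ∑ _e ∈ goodPairs t a, (1 : ℝ) := by
    have : ∀ a : Fin k, n * totalWt k t / 12 ≤ ∑ _j : Fin n, ∑ _e ∈ goodPairs t a, (1 : ℝ) := by
      intro a
      have h := totalWt_le_card_goodPairs hk htk a
      simp only [Finset.sum_const, nsmul_eq_mul, mul_one, Finset.card_univ, Fintype.card_fin]
      have hn : (0 : ℝ) ≤ n := by positivity
      nlinarith [mul_le_mul_of_nonneg_left h hn]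
    refine le_trans (le_of_eq ?_) (Finset.sum_le_sum fun a _ => this a)
    simp; ring
  set N := ∑ a : Fin k, ∑ _j : Fin n, ∑ _e ∈ goodPairs t a, (1 : ℝ) with hN
  have hninth : ∑ a : Fin k, ∑ _j : Fin n, ∑ _e ∈ goodPairs t a, (1 / 9 : ℝ) = 1 / 9 * N := by
    simp only [hN, Finset.mul_sum, mul_one]
  rw [hninth]
  have hfac : 0 ≤ ((t : ℝ) + 1) / (48 * k * totalWt k t) := by positivity
  calc ((t : ℝ) + 1) * n / 5184
      = ((t : ℝ) + 1) / (48 * k * totalWt k t) * (1 / 9 * (k * n * totalWt k t / 12)) := by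
        field_simp; ring
    _ ≤ _ := by
        refine mul_le_mul_of_nonneg_left ?_ hfac
        have h := sub_le_sub_right (mul_le_mul_of_nonneg_left hgap
          (by norm_num : (0 : ℝ) ≤ 2 / 3)) (1 / 9 * N)
        refine le_trans ?_ (h.trans_eq ?_)
        · linarith
        · unfold Protocol.acceptProb
          congr!

/-! ### Fixing the random tapes; planted inputs -/

open scoped Classical in
/-- Averaging over the random tapes: if every input is handled badly with probability at most
`1 / 3`, then some outcome of the tapes is bad for at most a third of a given distribution
over inputs. -/
theorem exists_sum_indicator_le {Ω ι : Type*} [MeasurableSpace Ω] (μ : Measure Ω)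
    [IsProbabilityMeasure μ] [Fintype ι] (c : ι → ℝ) (hc : ∀ i, 0 ≤ c i) (bad : ι → Ω → Prop)
    (h : ∀ i, c i ≠ 0 → μ {ω | bad i ω} ≤ 1 / 3) :
    ∃ ω, ∑ i, c i * (if bad i ω then 1 else 0) ≤ 1 / 3 * ∑ i, c i := by
  -- The bad events need not be measurable; their measurable hulls have the same measure.
  set B : ι → Set Ω := fun i => toMeasurable μ {ω | bad i ω} with hB
  have hint : Integrable (fun ω => ∑ i, c i * (B i).indicator (fun _ => (1 : ℝ)) ω) μ :=
    integrable_finsetSum _ fun i _ =>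
      ((integrable_const (1 : ℝ)).indicator (measurableSet_toMeasurable _ _)).const_mul _
  obtain ⟨ω, hω⟩ := exists_le_integral hint
  refine ⟨ω, le_trans (Finset.sum_le_sum fun i _ => ?_) (hω.trans ?_)⟩
  · refine mul_le_mul_of_nonneg_left ?_ (hc i)
    by_cases hb : bad i ω
    · rw [if_pos hb, Set.indicator_of_mem (show ω ∈ B i from subset_toMeasurable _ _ hb)]
    · rw [if_neg hb]
      exact Set.indicator_nonneg (fun _ _ => zero_le_one) _
  · rw [integral_finsetSum _ fun i _ =>
      ((integrable_const (1 : ℝ)).indicator (measurableSet_toMeasurable _ _)).const_mul _,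
      Finset.mul_sum]
    refine Finset.sum_le_sum fun i _ => ?_
    rw [integral_const_mul, integral_indicator_const _ (measurableSet_toMeasurable _ _),
      smul_eq_mul, mul_one, mul_comm]
    by_cases hi : c i = 0
    · simp [hi]
    · refine mul_le_mul_of_nonneg_right ?_ (hc i)
      rw [measureReal_def, measure_toMeasurable]
      have := ENNReal.toReal_mono (by simp) (h i hi)
      simpa using this

theorem card_le_of_colWt_ne_zero {k t : ℕ} {B : Finset (Fin k)} (h : colWt t B ≠ 0) :
    B.card ≤ t + 1 := by
  unfold colWt at h
  split_ifs at h with h1 h2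
  · omega
  · omega
  · exact absurd rfl h

theorem maxFreq_rowsOf_update {n k : ℕ} (S : Fin n → Finset (Fin k)) (j : Fin n)
    (B : Finset (Fin k)) (h : ∀ i, (S i).card ≤ B.card) :
    maxFreq (rowsOf (Function.update S j B)) = B.card := by
  refine le_antisymm (Finset.sup_le fun x _ => ?_) ?_
  · rw [freq_rowsOf]
    by_cases hx : x = j
    · subst hx; simp
    · simpa [hx] using h x
  · have := Finset.le_sup (f := freq (rowsOf (Function.update S j B))) (Finset.mem_univ j)
    rw [freq_rowsOf, Function.update_self] at this
    exact this

/-- The two columns that are compared: frequency `t + 2` with `a`, frequency `t + 1` without. -/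
def plantedCol {k : ℕ} (a : Fin k) (e : Finset (Fin k) × Fin k) (c : Bool) : Finset (Fin k) :=
  if c then insert a (insert e.2 e.1) else insert e.2 e.1

theorem card_plantedCol {k t : ℕ} {a : Fin k} {e : Finset (Fin k) × Fin k}
    (he : e ∈ goodPairs t a) (c : Bool) :
    (plantedCol a e c).card = if c then t + 2 else t + 1 := by
  simp only [goodPairs, Finset.mem_filter, Finset.mem_univ, true_and] at he
  obtain ⟨h1, h2, h3, h4⟩ := he
  have h5 : (insert e.2 e.1).card = t + 1 := by rw [Finset.card_insert_of_notMem h3, h1]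
  have h6 : a ∉ insert e.2 e.1 := by simp [h2, h4.symm]
  cases c
  · simpa [plantedCol] using h5
  · simp only [plantedCol, if_true]
    rw [Finset.card_insert_of_notMem h6, h5]

theorem maxFreq_plantedCol {n k t : ℕ} {a : Fin k} {e : Finset (Fin k) × Fin k}
    (he : e ∈ goodPairs t a) (c : Bool) (j : Fin n) {S : Fin n → Finset (Fin k)}
    (hS : ∀ i, colWt t (S i) ≠ 0) :
    maxFreq (rowsOf (Function.update S j (plantedCol a e c))) = if c then t + 2 else t + 1 := by
  rw [maxFreq_rowsOf_update, card_plantedCol he]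
  intro i
  have := card_le_of_colWt_ne_zero (hS i)
  rw [card_plantedCol he]
  split_ifs <;> omega

theorem plantedCol_mem_inputs {n k L t : ℕ} (h1 : t + 2 ≤ L) (h2 : min L k ≤ 2 * (t + 1))
    {a : Fin k} {e : Finset (Fin k) × Fin k}
    (he : e ∈ goodPairs t a) (c : Bool) (j : Fin n) {S : Fin n → Finset (Fin k)}
    (hS : ∀ i, colWt t (S i) ≠ 0) :
    rowsOf (Function.update S j (plantedCol a e c)) ∈ maxFreqInputs n k L := by
  change _ ≤ L ∧ _ ≤ 2 * _
  rw [maxFreq_plantedCol he c j hS]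
  split_ifs <;> omega

theorem colMean_add {n k t : ℕ} (F G : (Fin n → Finset (Fin k)) → ℝ) :
    colMean t (fun S => F S + G S) = colMean t F + colMean t G := by
  simp only [colMean, mul_add, Finset.sum_add_distrib, add_div]

/-- The answer given by one run on one input is wrong. -/
def CommProblem.Fails {k : ℕ} {X Y : Type} (F : CommProblem k X Y) (P : Protocol k X Y)
    (x : Fin k → X) : Prop :=
  ¬ ∃ y, P.Outputs x y ∧ F.correct x y

open scoped Classical in
/-- The probability of a wrong answer when column `j` is `B` and the others are random. -/
noncomputable def CommProblem.failProb {n k : ℕ} {Y : Type} (F : CommProblem k (Finset (Fin n)) Y)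
    (P : Protocol k (Finset (Fin n)) Y) (t : ℕ) (j : Fin n) (B : Finset (Fin k)) : ℝ :=
  colMean t fun S => if F.Fails P (rowsOf (Function.update S j B)) then (1 : ℝ) else 0

/-- One outcome of the tapes is chosen for all `a`, `j`, `e`, `c` and background columns at once.
`s` lists the planted variants tested: both for the value, only size `t + 2` for the element. -/
theorem exists_run_failProb_le {n k L t : ℕ} {Y : Type} (h1 : t + 2 ≤ L)
    (h2 : min L k ≤ 2 * (t + 1)) (hM : 0 < totalWt k t) (F : CommProblem k (Finset (Fin n)) Y)
    (hF : F.inputs = maxFreqInputs n k L) (P : RandomizedProtocol k (Finset (Fin n)) Y)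
    (hP : P.Solves F (1 / 3)) (s : Finset Bool) :
    ∃ ω, ∑ a : Fin k, ∑ j : Fin n, ∑ e ∈ goodPairs t a, ∑ c ∈ s,
        F.failProb (P.run ω) t j (plantedCol a e c)
      ≤ 1 / 3 * ∑ a : Fin k, ∑ _j : Fin n, ∑ _e ∈ goodPairs t a, ∑ _c ∈ s, (1 : ℝ) := by
  classical
  let _ := P.mΩ
  have := P.isProb
  set I := (Finset.univ : Finset (Fin k)).sigma fun a =>
    (Finset.univ : Finset (Fin n)) ×ˢ goodPairs t a ×ˢ s with hI
  have key := exists_sum_indicator_le P.law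
    (fun q : I × (Fin n → Finset (Fin k)) => (∏ i, colWt t (q.2 i)) / totalWt k t ^ n)
    (fun q => div_nonneg (Finset.prod_nonneg fun i _ => colWt_nonneg t _) (by positivity))
    (fun q ω => F.Fails (P.run ω) (rowsOf (Function.update q.2 q.1.1.2.1
      (plantedCol q.1.1.1 q.1.1.2.2.1 q.1.1.2.2.2)))) ?_
  · obtain ⟨ω, hω⟩ := key
    refine ⟨ω, ?_⟩
    have conv : ∀ G : (Σ _ : Fin k, Fin n × (Finset (Fin k) × Fin k) × Bool) → ℝ,
        ∑ a : Fin k, ∑ j : Fin n, ∑ e ∈ goodPairs t a, ∑ c ∈ s, G ⟨a, j, e, c⟩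
          = ∑ q : I, G q := by
      intro G
      rw [Finset.sum_coe_sort I G, hI, Finset.sum_sigma]
      simp only [Finset.sum_product]
    have c1 := conv fun q => F.failProb (P.run ω) t q.2.1 (plantedCol q.1 q.2.2.1 q.2.2.2)
    have c2 := conv fun _ => 1
    simp only at c1 c2
    rw [c1, c2]
    refine le_trans (le_of_eq ?_) (hω.trans (le_of_eq ?_))
    · rw [Fintype.sum_prod_type]
      refine Finset.sum_congr rfl fun q _ => ?_
      unfold CommProblem.failProb colMean
      rw [Finset.sum_div]
      refine Finset.sum_congr rfl fun S _ => ?_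
      simp only
      rw [div_mul_eq_mul_div]
    · rw [Fintype.sum_prod_type]
      congr 1
      refine Finset.sum_congr rfl fun q _ => ?_
      have h := colMean_const (n := n) hM 1
      unfold colMean at h
      rw [Finset.sum_div] at h
      simpa using h
  · rintro ⟨⟨⟨a, j, e, c⟩, hq⟩, S⟩ hne
    simp only [hI, Finset.mem_sigma, Finset.mem_univ, Finset.mem_product, true_and] at hq
    have hS : ∀ i, colWt t (S i) ≠ 0 := by
      intro i hi
      exact hne (by simp only; rw [Finset.prod_eq_zero (Finset.mem_univ i) hi, zero_div])
    exact hP _ (hF ▸ plantedCol_mem_inputs h1 h2 hq.1 c j hS)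

theorem one_sub_failProb_le_acceptProb {n k L t : ℕ} {Y T : Type} (h1 : t + 2 ≤ L)
    (h2 : min L k ≤ 2 * (t + 1)) (hM : 0 < totalWt k t) (F : CommProblem k (Finset (Fin n)) Y)
    (hF : F.inputs = maxFreqInputs n k L) (P : Protocol k (Finset (Fin n)) Y) (C : ℕ)
    (hC : ∀ x ∈ F.inputs, P.UsesAtMost x C) (τ : Y → T) {a : Fin k}
    {e : Finset (Fin k) × Fin k} (he : e ∈ goodPairs t a) (j : Fin n) (y₀ : T)
    (hcorrect : ∀ S : Fin n → Finset (Fin k), (∀ i, colWt t (S i) ≠ 0) →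
      ∀ y, F.correct (rowsOf (Function.update S j (plantedCol a e true))) y → τ y = y₀) :
    1 - F.failProb P t j (plantedCol a e true)
      ≤ P.acceptProb C τ t j (insert a (insert e.2 e.1)) y₀ := by
  rw [sub_le_iff_le_add, ← colMean_const (n := n) hM 1]
  unfold Protocol.acceptProb CommProblem.failProb
  rw [← colMean_add]
  refine colMean_mono t fun S hS => ?_
  by_cases hf : F.Fails P (rowsOf (Function.update S j (plantedCol a e true)))
  · rw [if_pos hf]
    split_ifs <;> norm_num
  · rw [if_neg hf]
    rw [CommProblem.Fails, not_not] at hf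
    obtain ⟨y, hy, hy'⟩ := hf
    have hu := hC _ (hF ▸ plantedCol_mem_inputs h1 h2 he true j hS)
    have ho := P.outcome_eq_of_outputs C τ hu hy
    rw [hcorrect S hS y hy'] at ho
    have : plantedCol a e true = insert a (insert e.2 e.1) := rfl
    rw [this] at ho
    rw [if_pos ho]; norm_num

theorem acceptProb_le_failProb {n k L t : ℕ} {Y T : Type} (h1 : t + 2 ≤ L)
    (h2 : min L k ≤ 2 * (t + 1)) (F : CommProblem k (Finset (Fin n)) Y)
    (hF : F.inputs = maxFreqInputs n k L) (P : Protocol k (Finset (Fin n)) Y) (C : ℕ)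
    (hC : ∀ x ∈ F.inputs, P.UsesAtMost x C) (τ : Y → T) {a : Fin k}
    {e : Finset (Fin k) × Fin k} (he : e ∈ goodPairs t a) (j : Fin n) (y₀ : T)
    (hcorrect : ∀ S : Fin n → Finset (Fin k), (∀ i, colWt t (S i) ≠ 0) →
      ∀ y, F.correct (rowsOf (Function.update S j (plantedCol a e false))) y → τ y ≠ y₀) :
    P.acceptProb C τ t j (insert e.2 e.1) y₀ ≤ F.failProb P t j (plantedCol a e false) := by
  refine colMean_mono t fun S hS => ?_
  by_cases hf : F.Fails P (rowsOf (Function.update S j (plantedCol a e false)))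
  · rw [if_pos hf]
    split_ifs <;> norm_num
  · rw [if_neg hf]
    rw [CommProblem.Fails, not_not] at hf
    obtain ⟨y, hy, hy'⟩ := hf
    have hu := hC _ (hF ▸ plantedCol_mem_inputs h1 h2 he false j hS)
    have ho := P.outcome_eq_of_outputs C τ hu hy
    have : plantedCol a e false = insert e.2 e.1 := rfl
    rw [this] at ho
    rw [if_neg]
    rw [ho, Option.some_inj]
    exact hcorrect S hS y hy'

/-- A single answer can be right for few planted elements: the answers are disjoint events. -/
theorem sum_acceptProb_le {n k t : ℕ} {Y : Type} (hM : 0 < totalWt k t)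
    (P : Protocol k (Finset (Fin n)) Y) (C : ℕ) (τ : Y → Fin n) (a : Fin k) :
    ∑ j : Fin n, ∑ e ∈ goodPairs t a, P.acceptProb C τ t j (insert e.2 e.1) j
      ≤ totalWt k t := by
  classical
  have h0 : ∀ (j : Fin n) (B : Finset (Fin k)), 0 ≤ P.acceptProb C τ t j B j := by
    intro j B
    unfold Protocol.acceptProb
    refine (colMean_const (n := n) hM 0).ge.trans (colMean_mono t fun S _ => ?_)
    split_ifs <;> norm_num
  have h1 : ∀ j : Fin n, ∑ e ∈ goodPairs t a, P.acceptProb C τ t j (insert e.2 e.1) j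
      ≤ ∑ B, colWt t B * P.acceptProb C τ t j B j := by
    intro j
    have h2 : ∑ B, colWt t B * P.acceptProb C τ t j B j
        = ∑ d : (Finset (Fin k) × Fin k) × Bool,
          splitWt t a d.1 * P.acceptProb C τ t j (splitVal d.1 d.2) j := by
      rw [← Finset.sum_fiberwise (g := fun d : (Finset (Fin k) × Fin k) × Bool =>
        splitVal d.1 d.2)]
      refine Finset.sum_congr rfl fun B _ => ?_
      rw [← sum_splitWt_fiber t a B, Finset.sum_mul]
      exact Finset.sum_congr rfl fun d hd => by rw [(Finset.mem_filter.1 hd).2]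
    rw [h2, Fintype.sum_prod_type]
    refine le_trans ?_ (Finset.sum_le_sum_of_subset_of_nonneg
      (Finset.subset_univ (goodPairs t a)) fun e _ _ => Finset.sum_nonneg fun c _ =>
        mul_nonneg (splitWt_nonneg _ _ _) (h0 _ _))
    refine Finset.sum_le_sum fun e he => ?_
    simp only [goodPairs, Finset.mem_filter, Finset.mem_univ, true_and] at he
    have hw : splitWt t a e = 1 := by simp [splitWt, he]
    rw [Fintype.sum_bool, hw, one_mul, one_mul]
    have := h0 j (splitVal e false)
    simpa [splitVal] using this
  refine (Finset.sum_le_sum fun j _ => h1 j).trans ?_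
  unfold Protocol.acceptProb
  -- Good pairs have weight one, so planting size `t + 1` is dominated by redrawing column `j` from
  -- its own law. That leaves the input law unchanged, and the events of answering `j` are then
  -- disjoint.
  have h3 : ∀ j : Fin n, ∑ B, colWt t B * colMean t (fun S =>
      if P.outcome C τ (rowsOf (Function.update S j B)) = some j then (1 : ℝ) else 0)
      = totalWt k t * colMean t
        (fun S => if P.outcome C τ (rowsOf S) = some j then (1 : ℝ) else 0) := fun j =>
    colMean_resample t j fun S => if P.outcome C τ (rowsOf S) = some j then (1 : ℝ) else 0
  have h4 : colMean t (fun S : Fin n → Finset (Fin k) =>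
      ∑ j : Fin n, if P.outcome C τ (rowsOf S) = some j then (1 : ℝ) else 0) ≤ 1 := by
    refine le_trans (colMean_mono t fun S _ => ?_) (colMean_const (n := n) hM 1).le
    cases P.outcome C τ (rowsOf S) with
    | none => simp
    | some y => simp
  rw [colMean_sum] at h4
  have h5 := mul_le_mul_of_nonneg_left h4 hM.le
  rw [mul_one, Finset.mul_sum] at h5
  refine le_trans (le_of_eq ?_) h5
  refine Finset.sum_congr rfl fun j _ => ?_
  rw [← h3 j]
  congr!

/-! ### The two problems and the choice of constants -/

/-- Whether the answer is `t + 2` decides the planted case. The two average errors sum to at most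
`2/3`, which leaves a gap of `1/3`. -/
theorem computeMaxFreq_lower_bound {n k L t C : ℕ} (hk : 2 ≤ k) (hn : 2 ≤ n)
    (htk : 2 * t + 1 ≤ k) (h1 : t + 2 ≤ L) (h2 : min L k ≤ 2 * (t + 1))
    (P : RandomizedProtocol k (Finset (Fin n)) ℕ)
    (hP : P.Solves (computeMaxFreq n k L) (1 / 3)) (hC : P.CostAtMost (computeMaxFreq n k L) C) :
    ((t : ℝ) + 1) * n / 5184 ≤ 8 * C * Real.log k + 4 + Real.log n + Real.log k := by
  have hM : 0 < totalWt k t := totalWt_pos (by omega)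
  obtain ⟨ω, hω⟩ := exists_run_failProb_le h1 h2 hM (computeMaxFreq n k L) rfl P hP
    Finset.univ
  have hrun : ∀ x ∈ (computeMaxFreq n k L).inputs, (P.run ω).UsesAtMost x C := fun x hx =>
    hC x hx ω
  have main := communication_lower_bound hk htk (T := Bool) (by simp) (P.run ω) C
    (fun v => decide (v = t + 2)) (fun _ => true) ?_
  · have : Real.log (Fintype.card Bool) ≤ Real.log n :=
      Real.log_le_log (by simp) (by simpa using hn)
    linarith
  · simp only [Fintype.sum_bool, Finset.sum_add_distrib] at hω
    have gap : ∑ a : Fin k, ∑ j : Fin n, ∑ e ∈ goodPairs t a,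
        (1 - (computeMaxFreq n k L).failProb (P.run ω) t j (plantedCol a e true)
          - (computeMaxFreq n k L).failProb (P.run ω) t j (plantedCol a e false)) ≤
        ∑ a : Fin k, ∑ j : Fin n, ∑ e ∈ goodPairs t a,
          ((P.run ω).acceptProb C (fun v => decide (v = t + 2)) t j
              (insert a (insert e.2 e.1)) true
            - (P.run ω).acceptProb C (fun v => decide (v = t + 2)) t j (insert e.2 e.1) true) := by
      refine Finset.sum_le_sum fun a _ => Finset.sum_le_sum fun j _ =>
        Finset.sum_le_sum fun e he => sub_le_sub ?_ ?_
      · refine one_sub_failProb_le_acceptProb h1 h2 hM _ rfl _ C hrun _ he j _ ?_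
        intro S hS y hy
        rw [show y = _ from hy, maxFreq_plantedCol he true j hS]
        simp
      · refine acceptProb_le_failProb h1 h2 _ rfl _ C hrun _ he j _ ?_
        intro S hS y hy
        rw [show y = _ from hy, maxFreq_plantedCol he false j hS]
        simp
    refine le_trans ?_ gap
    simp only [Finset.sum_sub_distrib]
    linarith

/-- With size `t + 2` planted at `j`, only `j` is correct, so it is answered with average
probability at least `2/3`. With size `t + 1` the average is at most `12 / n`, hence at most `1/3`
for `n ≥ 36`. -/
theorem findMaxFreqElement_lower_bound {n k L t C : ℕ} (hk : 2 ≤ k) (hn : 36 ≤ n)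
    (htk : 2 * t + 1 ≤ k) (h1 : t + 2 ≤ L) (h2 : min L k ≤ 2 * (t + 1))
    (P : RandomizedProtocol k (Finset (Fin n)) (Fin n))
    (hP : P.Solves (findMaxFreqElement n k L) (1 / 3))
    (hC : P.CostAtMost (findMaxFreqElement n k L) C) :
    ((t : ℝ) + 1) * n / 5184 ≤ 8 * C * Real.log k + 4 + Real.log n + Real.log k := by
  have hM : 0 < totalWt k t := totalWt_pos (by omega)
  obtain ⟨ω, hω⟩ := exists_run_failProb_le h1 h2 hM (findMaxFreqElement n k L) rfl P hP {true}
  have hrun : ∀ x ∈ (findMaxFreqElement n k L).inputs, (P.run ω).UsesAtMost x C := fun x hx =>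
    hC x hx ω
  have main := communication_lower_bound hk htk (T := Fin n) (by simp; omega) (P.run ω) C
    id id ?_
  · simpa using main
  · simp only [Finset.sum_singleton] at hω
    have gap : ∑ a : Fin k, ∑ j : Fin n, ∑ e ∈ goodPairs t a,
        (1 - (findMaxFreqElement n k L).failProb (P.run ω) t j (plantedCol a e true)
          - (P.run ω).acceptProb C id t j (insert e.2 e.1) j) ≤
        ∑ a : Fin k, ∑ j : Fin n, ∑ e ∈ goodPairs t a,
          ((P.run ω).acceptProb C id t j (insert a (insert e.2 e.1)) (id j)
            - (P.run ω).acceptProb C id t j (insert e.2 e.1) (id j)) := by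
      refine Finset.sum_le_sum fun a _ => Finset.sum_le_sum fun j _ =>
        Finset.sum_le_sum fun e he => sub_le_sub ?_ le_rfl
      refine one_sub_failProb_le_acceptProb h1 h2 hM _ rfl _ C hrun _ he j _ ?_
      rintro S hS y ⟨_, hy⟩
      rw [maxFreq_plantedCol he true j hS, freq_rowsOf] at hy
      by_contra hne
      have hyj : y ≠ j := hne
      rw [Function.update_of_ne hyj] at hy
      have := card_le_of_colWt_ne_zero (hS y)
      simp at hy
      omega
    refine le_trans ?_ gap
    simp only [Finset.sum_sub_distrib]
    have few : ∑ a : Fin k, ∑ j : Fin n, ∑ e ∈ goodPairs t a,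
        (P.run ω).acceptProb C id t j (insert e.2 e.1) j ≤ k * totalWt k t := by
      refine (Finset.sum_le_sum fun a _ => sum_acceptProb_le hM (P.run ω) C id a).trans ?_
      simp
    have many : k * totalWt k t
        ≤ 1 / 3 * ∑ a : Fin k, ∑ _j : Fin n, ∑ _e ∈ goodPairs t a, (1 : ℝ) := by
      have h3 : ∀ a : Fin k, 3 * totalWt k t ≤ ∑ _j : Fin n, ∑ _e ∈ goodPairs t a, (1 : ℝ) := by
        intro a
        have h := totalWt_le_card_goodPairs hk htk a
        simp only [Finset.sum_const, nsmul_eq_mul, mul_one, Finset.card_univ, Fintype.card_fin]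
        have hn' : (36 : ℝ) ≤ n := by exact_mod_cast hn
        have := mul_le_mul_of_nonneg_right hn' (Nat.cast_nonneg (α := ℝ) (goodPairs t a).card)
        linarith
      have h4 := Finset.sum_le_sum fun a (_ : a ∈ (Finset.univ : Finset (Fin k))) => h3 a
      simp only [Finset.sum_const (3 * totalWt k t), Finset.card_univ, Fintype.card_fin,
        nsmul_eq_mul] at h4
      linarith
    linarith

theorem ofReal_le_randomizedCC {k : ℕ} {X Y : Type} (F : CommProblem k X Y) (δ : ℝ≥0∞) (r : ℝ)
    (h : ∀ (C : ℕ) (P : RandomizedProtocol k X Y), P.Solves F δ → P.CostAtMost F C → r ≤ C) :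
    ENNReal.ofReal r ≤ (randomizedCC δ F : ℝ≥0∞) := by
  have h1 : ((⌈r⌉₊ : ℕ) : ℕ∞) ≤ randomizedCC δ F := by
    refine le_iInf₂ fun C hC => ?_
    obtain ⟨P, hP, hP'⟩ := hC
    exact_mod_cast Nat.ceil_le.2 (h C P hP hP')
  have h2 : (((⌈r⌉₊ : ℕ) : ℕ∞) : ℝ≥0∞) ≤ (randomizedCC δ F : ℝ≥0∞) := by
    exact_mod_cast h1
  refine le_trans ?_ h2
  rw [ENat.toENNReal_coe]
  refine ENNReal.ofReal_le_of_le_toReal ?_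
  simpa using Nat.le_ceil r

/-- The bound in terms of `min L k`, once `k` is large compared with `log n`. -/
theorem bits_lower_bound {n k m t C : ℕ} (hk : 2 ≤ k) (hlog : 100000 * Real.logb 2 n ≤ k)
    (hkn : k ≤ n) (hm : m ≤ 2 * (t + 1))
    (h : ((t : ℝ) + 1) * n / 5184 ≤ 8 * C * Real.log k + 4 + Real.log n + Real.log k) :
    1 / 200000 * (m : ℝ) * n / Real.logb 2 k ≤ C := by
  have hk' : (2 : ℝ) ≤ k := by exact_mod_cast hk
  have hkn' : (k : ℝ) ≤ n := by exact_mod_cast hkn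
  have hl2 : 0 < Real.log 2 := Real.log_pos (by norm_num)
  have hl2' : Real.log 2 ≤ 1 := by linarith [Real.log_two_lt_d9]
  have hlogb : ∀ x : ℝ, Real.log x = Real.logb 2 x * Real.log 2 := fun x => by
    rw [Real.logb, div_mul_cancel₀ _ hl2.ne']
  have h1k : 1 ≤ Real.logb 2 k := by
    rw [Real.le_logb_iff_rpow_le (by norm_num) (by linarith)]; simpa using hk'
  have hkn2 : Real.logb 2 k ≤ Real.logb 2 n :=
    Real.logb_le_logb_of_le (by norm_num) (by linarith) hkn'
  have hlk : Real.log k ≤ Real.logb 2 k := by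
    rw [hlogb]; nlinarith
  have hln : Real.log n ≤ Real.logb 2 n := by
    rw [hlogb]; nlinarith
  have hm' : (m : ℝ) ≤ 2 * (t + 1) := by exact_mod_cast hm
  rw [div_le_iff₀ (by linarith)]
  have hC := mul_le_mul_of_nonneg_left hlk (Nat.cast_nonneg (α := ℝ) C)
  have hn0 : (0 : ℝ) ≤ n := by linarith
  have ht : (0 : ℝ) ≤ t * n := by positivity
  have h5 := mul_le_mul_of_nonneg_right hm' hn0
  -- The additive terms are at most `6 log₂ n ≤ 6n / 100000`, and `(1/5184 - 6/100000) / 8` exceeds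
  -- `1/100000`; the bound `m ≤ 2 (t + 1)` costs another factor `2`.
  nlinarith

theorem mainTheorem4 :
    ∃ c : ℝ, 0 < c ∧ ∃ c₀ : ℝ, 0 < c₀ ∧
      ∀ n k L : ℕ, 2 ≤ k → c₀ * Real.logb 2 n ≤ k → k ≤ n → 2 ≤ L →
        ENNReal.ofReal (c * ((min L k : ℕ) : ℝ) * n / Real.logb 2 k)
            ≤ (randomizedCC (1 / 3) (findMaxFreqElement n k L) : ℝ≥0∞) ∧
        ENNReal.ofReal (c * ((min L k : ℕ) : ℝ) * n / Real.logb 2 k)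
            ≤ (randomizedCC (1 / 3) (computeMaxFreq n k L) : ℝ≥0∞) := by
  refine ⟨1 / 200000, by norm_num, 100000, by norm_num, fun n k L hk hlog hkn hL => ?_⟩
  have hk' : (2 : ℝ) ≤ k := by exact_mod_cast hk
  have hn : 36 ≤ n := by
    have h1 : 1 ≤ Real.logb 2 n := by
      have hn2 : (2 : ℝ) ≤ n := by exact_mod_cast hk.trans hkn
      rw [Real.le_logb_iff_rpow_le (by norm_num) (by linarith)]; simpa using hn2
    have h2 : (36 : ℝ) ≤ k := by linarith
    have h3 : 36 ≤ k := by exact_mod_cast h2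
    omega
  -- Take `t + 1` as half of `min L k`, rounded up: the least admissible maximum frequency. With `L
  -- ≥ 2` this still leaves room for `t + 2 ≤ L`.
  obtain ⟨t, ht⟩ : ∃ t, t + 1 = (min L k + 1) / 2 := ⟨(min L k + 1) / 2 - 1, by omega⟩
  have htk : 2 * t + 1 ≤ k := by omega
  have htL : t + 2 ≤ L := by omega
  have hm : min L k ≤ 2 * (t + 1) := by omega
  exact ⟨ofReal_le_randomizedCC _ _ _ fun C P hP hC => bits_lower_bound hk hlog hkn hm
      (findMaxFreqElement_lower_bound hk hn htk htL hm P hP hC),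
    ofReal_le_randomizedCC _ _ _ fun C P hP hC => bits_lower_bound hk hlog hkn hm
      (computeMaxFreq_lower_bound hk (by omega) htk htL hm P hP hC)⟩
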